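/- **Setting.** Let $\mathbb K$ be $\mathbb R$ or $\mathbb C$, let $\mathcal A$ be a unital associative $*$-algebra over $\mathbb K$ on which the group of time translations $T_\tau$ ($\tau\in\mathbb R$) and space translations $T_x$ ($x\in\mathbb R^d$) acts by $*$-automorphisms, and write $A(\tau,x)=T_\tau T_xA$. Let $\omega$ be a stationary translation-invariant state (a positive Hermitian linear functional), $\mathcal H=\mathcal A\Phi$ its GNS pre-Hilbert space, with $\omega(A)=\langle A\Phi,\Phi\rangle$, and $\overline{\mathcal H}$ the completion; assume that the translations act strongly continuously on $\overline{\mathcal H}$. Let $E(k)$, $k\in\mathbb R^d$, be Hermitian $m\times m$ matrices, smooth in $k$ and, with all derivatives, of at most polynomial growth (if $\mathbb K=\mathbb R$, also $E(-k)=-\overline{E(k)}$). The elementary space $\mathfrak h$ is the space of $\mathbb K$-valued Schwartz functions on $\mathbb R^d\times\{1,\dots,m\}$ with the $L^2$ metric; in the momentum representation $\hat g(k)=\int e^{ik\cdot x}g(x)\,dx$, $T_x$ is multiplication by $e^{ik\cdot x}$ and $T_\tau$ is multiplication by $e^{-i\tau E(k)}$. Let $g\mapsto\Phi(g)$ be an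 elementary excitation, i.e. an isometric linear map $\mathfrak h\to\mathcal H$ commuting with translations. Let $B_1,\dots,B_m\in\mathcal A$ act by bounded operators and be good: $B_j\Phi=\Phi(\phi_j)$ and $B_j^*\Phi=\Phi(\psi_j)$ with $\phi_j,\psi_j\in\mathfrak h$, where for each $k$ the square matrix with columns $\hat\phi_1(k),\dots,\hat\phi_m(k)$ is invertible and commutes with $E(k)$. Assume asymptotic commutativity: for all $j,k$ and every $N\in\mathbb N$ there is a polynomial $C_N$ such that $\|[B_j(\tau,x),B_k]\|\le C_N(\tau)/(1+|x|^N)$ for all $\tau,x$. For $f=(f^1,\dots,f^m)$, $f^j\in\mathcal S(\mathbb R^d)$ complex-valued (with $\overline{f^j(k)}=f^j(-k)$ if $\mathbb K=\mathbb R$), put $f_\tau(k)=e^{i\tau E(k)}f(k)$, $\tilde f_\tau(x)=(2\pi)^{-d}\int e^{-ik\cdot x}f_\tau(k)\,dk$ and $B(f,\tau)=\sum_j\int\tilde f_\tau^j(x)B_j(\tau,x)\,dx$, an operator on $\overline{\mathcal H}$. A set $K\subset\mathbb R^d$ defines an essential support $\tau K$ of $\tilde f_\tau$ if for every $N$ there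 is $C_N$ with $|\tilde f_\tau^j(x)|\le C_N(1+|x|^2+\tau^2)^{-N}$ for all $j$, all $\tau\ne0$ and all $x$ with $x/\tau\notin K$. The collections $f_1,\dots,f_n$ are non-overlapping if they have such sets $K_1,\dots,K_n$ with pairwise positive distances. **Lemma.** If $f_1,\dots,f_n$ are non-overlapping, then the vectors $$\Psi(f_1,\tau_1,\dots,f_n,\tau_n)=B(f_1,\tau_1)\cdots B(f_n,\tau_n)\Phi$$ have a limit $\Psi(f_1,\dots,f_n|-\infty)$ in $\overline{\mathcal H}$ as $\tau_1,\dots,\tau_n\to-\infty$, in the following sense. They converge to it along common times $\tau_1=\dots=\tau_n=\tau\to-\infty$; and for every $p\in\mathbb N$ they converge to the same vector as all $\tau_j\to-\infty$ independently within the region $|\tau_a|\le|\tau_b|^p$ for all $1\le a<b\le n-1$ (for $n\le2$ this is no restriction). The linear span of the vectors $\Psi(f_1,\dots,f_n|-\infty)$, over all $n$ and all non-overlapping $f_1,\dots,f_n$, is the domain $\mathcal D_-$, defined as the span of all limits of $\Psi(f_1,\tau,\dots,f_n,\tau)$ as $\tau\to-\infty$ for non-overlapping families. -/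

import Mathlib

open Filter Topology MeasureTheory
open scoped SchwartzMap FourierTransform InnerProductSpace

noncomputable section

namespace Scattering

/-- A state on a unital `*`-algebra over `𝕜` (`ℝ` or `ℂ`): a positive Hermitian linear functional.
Over `ℂ` Hermiticity follows from positivity; over `ℝ` it has to be demanded for
`(a, b) ↦ ω (a⋆ b)` to be symmetric. No normalization is imposed. -/
structure PosFunctional (𝕜 A : Type*) [RCLike 𝕜] [Ring A] [Algebra 𝕜 A] [StarRing A]
    [StarModule 𝕜 A] where
  toFun : A →ₗ[𝕜] 𝕜
  hermitian : ∀ a, toFun (star a) = starRingEnd 𝕜 (toFun a)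
  nonneg : ∀ a, 0 ≤ RCLike.re (toFun (star a * a))

/-- Space `ℝ^d` (positions or momenta), with the Euclidean norm. -/
abbrev Space (d : ℕ) := EuclideanSpace ℝ (Fin d)

/-- An action of the commutative group of time and space translations by automorphisms of the
`*`-algebra `A`. -/
abbrev TranslationAction (𝕜 A : Type*) (d : ℕ) [RCLike 𝕜] [Ring A] [Algebra 𝕜 A] [StarRing A] :=
  Multiplicative (ℝ × Space d) →* (A ≃⋆ₐ[𝕜] A)

section GNS

variable {𝕜 A : Type*} [RCLike 𝕜] [Ring A] [Algebra 𝕜 A] [StarRing A] [StarModule 𝕜 A]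
variable (ω : PosFunctional 𝕜 A)

set_option linter.unusedVariables false in
/-- The algebra `A` with the semi-inner product `⟪a, b⟫ = ω (a⋆ b)` of the GNS construction. -/
@[nolint unusedArguments]
def PreGNS (ω : PosFunctional 𝕜 A) : Type _ := A

instance : AddCommGroup (PreGNS ω) := inferInstanceAs (AddCommGroup A)
instance : Module 𝕜 (PreGNS ω) := inferInstanceAs (Module 𝕜 A)

/-- The identity map from the algebra to the GNS semi-inner product space. -/
def toPre : A ≃ₗ[𝕜] PreGNS ω := LinearEquiv.refl 𝕜 _

/-- The semi-inner product of the GNS construction. -/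
abbrev gnsCore : PreInnerProductSpace.Core 𝕜 (PreGNS ω) where
  inner a b := ω.toFun (star ((toPre ω).symm a) * (toPre ω).symm b)
  conj_inner_symm a b := by
    rw [← ω.hermitian]; simp
  re_inner_nonneg a := ω.nonneg _
  add_left a b c := by rw [map_add, star_add, add_mul, map_add]
  smul_left a b r := by simp

instance : SeminormedAddCommGroup (PreGNS ω) :=
  InnerProductSpace.Core.toSeminormedAddCommGroup (c := gnsCore ω)
instance : InnerProductSpace 𝕜 (PreGNS ω) := InnerProductSpace.ofCore (gnsCore ω)

/-- The completed GNS Hilbert space. -/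
abbrev GNS := UniformSpace.Completion (PreGNS ω)

/-- The map `a ↦ a Φ` from the algebra to the completed GNS space. Its range is the GNS
pre-Hilbert space. -/
def vec (a : A) : GNS ω := ((toPre ω a : PreGNS ω) : GNS ω)

/-- The cyclic vector `Φ`. -/
def vacuum : GNS ω := vec ω 1

/-- A linear map `L` of `A` induces a bounded operator `a Φ ↦ (L a) Φ` of the GNS space. -/
def InducesBounded (L : A →ₗ[𝕜] A) : Prop :=
  ∃ C : ℝ, ∀ a : A, ‖toPre ω (L a)‖ ≤ C * ‖toPre ω a‖

open Classical in
/-- The bounded operator on the completed GNS space that sends `a Φ` to `(L a) Φ`; it is only used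
for `L` with `InducesBounded ω L` (otherwise it is `0`). -/
def extendOp (L : A →ₗ[𝕜] A) : GNS ω →L[𝕜] GNS ω :=
  if h : InducesBounded ω L then
    (LinearMap.mkContinuousOfExistsBound
      ((toPre ω).toLinearMap ∘ₗ L ∘ₗ (toPre ω).symm.toLinearMap) h).completion
  else 0

/-- The element `a` acts as a bounded operator in the GNS representation. -/
def IsBoundedElement (a : A) : Prop := InducesBounded ω (LinearMap.mulLeft 𝕜 a)

/-- The bounded operator on the completed GNS space representing a bounded element `a`. -/
def rep (a : A) : GNS ω →L[𝕜] GNS ω := extendOp ω (LinearMap.mulLeft 𝕜 a)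

variable {d : ℕ} (T : TranslationAction 𝕜 A d)

/-- The element `a(τ, x) = T_τ T_x a`. -/
def shift (τ : ℝ) (x : Space d) (a : A) : A := T (Multiplicative.ofAdd (τ, x)) a

/-- The state is stationary and translation-invariant. -/
def IsInvariantState : Prop := ∀ τ x a, ω.toFun (shift T τ x a) = ω.toFun a

/-- The operator `T_τ T_x` on the completed GNS space (isometric if the state is invariant). -/
def translateOp (τ : ℝ) (x : Space d) : GNS ω →L[𝕜] GNS ω :=
  extendOp ω (T (Multiplicative.ofAdd (τ, x))).toAlgEquiv.toLinearMap

/-- Strong continuity of the translations of the completed GNS space (so that infinitesimal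
translations, energy and momentum, exist). -/
def IsStronglyContinuous : Prop :=
  ∀ v : GNS ω, Continuous fun p : ℝ × Space d => translateOp ω T p.1 p.2 v

end GNS

section Elementary

variable {𝕜 : Type*} [RCLike 𝕜] {d m : ℕ}

/-- The elementary space: rapidly decreasing `𝕜`-valued functions on `ℝ^d × {1, …, m}`, in the
position representation. -/
abbrev Elementary (𝕜 : Type*) [RCLike 𝕜] (d m : ℕ) := 𝓢(Space d, EuclideanSpace 𝕜 (Fin m))

/-- Momentum representation of an element of the elementary space:
`ĝ^α(k) = ∫ exp(i k·x) g^α(x) dx`. (Mathlib's `𝓕⁻ u ξ` is `∫ exp(2π i ξ·x) u(x) dx`.) -/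
def momentum (g : Elementary 𝕜 d m) (k : Space d) : Fin m → ℂ :=
  fun α => 𝓕⁻ (fun x : Space d => RCLike.map 𝕜 ℂ (g x α)) ((2 * Real.pi)⁻¹ • k)

/-- The standing assumptions on `E`: every `E(k)` is Hermitian, the entries are smooth and, with all
their derivatives, of at most polynomial growth; in the real case `E(-k) = - conj E(k)`, that is,
`exp(-iτE)` preserves the reality condition. -/
structure IsDispersion (𝕜 : Type*) [RCLike 𝕜] (E : Space d → Matrix (Fin m) (Fin m) ℂ) :
    Prop where
  hermitian : ∀ k, (E k).IsHermitian
  growth : ∀ α β, (fun k => E k α β).HasTemperateGrowth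
  reality : (RCLike.I : 𝕜) = 0 → ∀ k α β, E (-k) α β = - starRingEnd ℂ (E k α β)

/-- The matrix `exp(iτE(k))`. -/
def evol (E : Space d → Matrix (Fin m) (Fin m) ℂ) (τ : ℝ) (k : Space d) :
    Matrix (Fin m) (Fin m) ℂ :=
  NormedSpace.exp ((Complex.I * (τ : ℂ)) • E k)

/-- `g' = T_τ T_x g` in the elementary space: in the momentum representation `g'` is
`exp(i k·x) exp(-iτE(k)) ĝ(k)`. -/
def IsTranslate (E : Space d → Matrix (Fin m) (Fin m) ℂ) (τ : ℝ) (x : Space d)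
    (g g' : Elementary 𝕜 d m) : Prop :=
  ∀ k, momentum g' k =
    Complex.exp (Complex.I * ((⟪k, x⟫_ℝ : ℝ) : ℂ)) • (evol E (-τ) k).mulVec (momentum g k)

/-- A collection `f = (f^1(k), …, f^m(k))` of Schwartz functions of the momentum. -/
abbrev Family (d m : ℕ) := Fin m → 𝓢(Space d, ℂ)

/-- In the real case the reality condition `conj f(k) = f(-k)`; no condition in the complex case. -/
def IsReal (𝕜 : Type*) [RCLike 𝕜] (f : Family d m) : Prop :=
  (RCLike.I : 𝕜) = 0 → ∀ j k, starRingEnd ℂ (f j k) = f j (-k)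

/-- The position-space function `x ↦ f̃^j_τ(x) = (2π)^{-d} ∫ exp(-i k·x) f^j_τ(k) dk`, where
`f_τ(k) = exp(iτE(k)) f(k)`. (The integral is written in the variable `ξ = k / 2π`, and
Mathlib's `𝓕 u x` is `∫ exp(-2π i x·ξ) u(ξ) dξ`.) -/
def wave (E : Space d → Matrix (Fin m) (Fin m) ℂ) (f : Family d m) (τ : ℝ) (j : Fin m)
    (x : Space d) : ℂ :=
  𝓕 (fun ξ : Space d =>
    (evol E τ ((2 * Real.pi) • ξ)).mulVec (fun i => f i ((2 * Real.pi) • ξ)) j) x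

/-- `τ K` is an essential support of `f̃_τ`: outside of it `f̃_τ(x)` is smaller than any power of
`(1 + |x|² + τ²)⁻¹`. -/
def IsEssentialSupport (E : Space d → Matrix (Fin m) (Fin m) ℂ) (f : Family d m)
    (K : Set (Space d)) : Prop :=
  ∀ N : ℕ, ∃ C : ℝ, ∀ (τ : ℝ) (x : Space d), τ ≠ 0 → τ⁻¹ • x ∉ K →
    ∀ j, ‖wave E f τ j x‖ ≤ C / (1 + ‖x‖ ^ 2 + τ ^ 2) ^ N

/-- Non-overlapping families: essential supports can be chosen with velocity sets `K_j` at positive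
mutual distance. -/
def NonOverlapping (E : Space d → Matrix (Fin m) (Fin m) ℂ) {n : ℕ} (f : Fin n → Family d m) :
    Prop :=
  ∃ K : Fin n → Set (Space d), (∀ a, IsEssentialSupport E (f a) (K a)) ∧
    ∀ a b, a ≠ b → ∃ δ > 0, ∀ u ∈ K a, ∀ v ∈ K b, δ ≤ dist u v

end Elementary

section Excitations

variable {𝕜 A : Type*} [RCLike 𝕜] [Ring A] [Algebra 𝕜 A] [StarRing A] [StarModule 𝕜 A]
variable {d m : ℕ} (ω : PosFunctional 𝕜 A) (T : TranslationAction 𝕜 A d)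
variable (E : Space d → Matrix (Fin m) (Fin m) ℂ)

/-- An elementary excitation: an isometric linear map of the elementary space (with the `L²` metric)
into the GNS pre-Hilbert space that commutes with time and space translations. -/
structure IsElementaryExcitation (exc : Elementary 𝕜 d m →ₗ[𝕜] GNS ω) : Prop where
  mem_pre : ∀ g, ∃ a : A, exc g = vec ω a
  isometric : ∀ g, ‖exc g‖ ^ 2 = ∫ x, ‖g x‖ ^ 2
  intertwines : ∀ τ x g g', IsTranslate E τ x g g' → exc g' = translateOp ω T τ x (exc g)

/-- The square matrix `φ(k)` with entry `φ_j^α(k)` in row `α` and column `j`. -/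
def momentumMatrix (φ : Fin m → Elementary 𝕜 d m) (k : Space d) : Matrix (Fin m) (Fin m) ℂ :=
  Matrix.of fun α j => momentum (φ j) k α

/-- `B_1, …, B_m` are good operators for the elementary excitation `exc`: they are bounded,
`B_j Φ` and `B_j⋆ Φ` are elementary excitations, and the matrix of the functions `φ_j`,
`B_j Φ = exc φ_j`, is invertible and commutes with `E(k)`. -/
structure IsGood (exc : Elementary 𝕜 d m →ₗ[𝕜] GNS ω) (B : Fin m → A)
    (φ : Fin m → Elementary 𝕜 d m) : Prop where
  bounded : ∀ j, IsBoundedElement ω (B j)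
  apply_vacuum : ∀ j, vec ω (B j) = exc (φ j)
  invertible : ∀ k, IsUnit (momentumMatrix φ k)
  commute : ∀ k, Commute (momentumMatrix φ k) (E k)
  star_apply_vacuum : ∀ j, ∃ ψ, vec ω (star (B j)) = exc ψ

/-- Asymptotic commutativity: for every `N` the commutators satisfy
`‖[B_j(τ, x), B_k]‖ ≤ C_N(τ) / (1 + ‖x‖^N)` with a polynomial `C_N`. -/
def AsymptoticallyCommute (B : Fin m → A) : Prop :=
  ∀ (N : ℕ) (j k : Fin m), ∃ C : Polynomial ℝ, ∀ (τ : ℝ) (x : Space d),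
    ‖rep ω (shift T τ x (B j)) * rep ω (B k) - rep ω (B k) * rep ω (shift T τ x (B j))‖
      ≤ C.eval τ / (1 + ‖x‖ ^ N)

variable (B : Fin m → A)

/-- The operator `B(f, τ) = ∑_j ∫ f̃^j_τ(x) B_j(τ, x) dx` on the completed GNS space. In the real
case `f̃^j_τ(x)` is real; `RCLike.map ℂ 𝕜` regards it as an element of `𝕜`. -/
def smeared (f : Family d m) (τ : ℝ) (v : GNS ω) : GNS ω :=
  letI : NormedSpace ℝ (GNS ω) := NormedSpace.restrictScalars ℝ 𝕜 (GNS ω)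
  ∑ j, ∫ x : Space d, RCLike.map ℂ 𝕜 (wave E f τ j x) • rep ω (shift T τ x (B j)) v

/-- The vector `Ψ(f_1, τ_1, …, f_n, τ_n) = B(f_1, τ_1) ⋯ B(f_n, τ_n) Φ`. -/
def scatVec {n : ℕ} (f : Fin n → Family d m) (τ : Fin n → ℝ) : GNS ω :=
  (List.finRange n).foldr (fun a v => smeared ω T E B (f a) (τ a) v) (vacuum ω)

/-- The domain `D_-`: the linear span of all limits of the vectors `Ψ(f_1, τ, …, f_n, τ)` as
`τ → -∞`, for all non-overlapping families `f_1, …, f_n` and all `n`. -/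
def domainMinus : Submodule 𝕜 (GNS ω) :=
  Submodule.span 𝕜 {v | ∃ (n : ℕ) (f : Fin n → Family d m), (∀ a, IsReal 𝕜 (f a)) ∧
    NonOverlapping E f ∧ Tendsto (fun τ : ℝ => scatVec ω T E B f fun _ => τ) atBot (𝓝 v)}

/-- Times `τ_1, …, τ_n` none of which is larger, by more than the power `p`, than a time to its
right other than the last one: `|τ_a| ≤ |τ_b|^p` for `a < b < n` (labels `1, …, n`). -/
def comparableTimes (n p : ℕ) : Set (Fin n → ℝ) :=
  {τ | ∀ a b : Fin n, a < b → (b : ℕ) + 1 < n → |τ a| ≤ |τ b| ^ p}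

/-- All times tend to `-∞`, within the region `comparableTimes n p`. -/
def remotePast (n p : ℕ) : Filter (Fin n → ℝ) :=
  Filter.pi (fun _ => atBot) ⊓ 𝓟 (comparableTimes n p)

end Excitations

end Scattering

end

/-!
The one-particle vectors `B(f, τ)Φ` do not depend on `τ`: in the momentum representation `B_j(τ, x)Φ`
is `exp(ik·x) exp(-iτE) φ_j`, so that integration against `f̃_τ` gives `exp(-iτE) φ exp(iτE) f = φ f`,
since `φ(k)` commutes with `E(k)` (`smearedOp_vacuum`). For non-overlapping families `f` and `g` the
commutator of `B(f, τ)` and `B(g, σ)` is rapidly decreasing in `|τ|` as long as `|τ - σ| ≤ 1`: the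
two waves live at distances of order `|τ|` from each other, up to rapidly decreasing tails, and the
commutators of `B_j(τ, x)` and `B_k(σ, y)` are rapidly decreasing in `|x - y|`
(`rapidlyCommute_smearedOp`). The velocity sets may be unbounded. Therefore the argument needs that
velocities larger than a multiple of `|τ|` contribute only rapidly decreasing terms, which follows
from the fact that each derivative of `exp(iτE(k))` in `k` costs only one power of `τ`
(`exists_norm_iteratedFDeriv_exp_comp_le`, `wave_bound`).

The rest is an argument on operators `O_a(τ)` of polynomially bounded norm that commute up to rapidly
decreasing terms and for which `O_a(τ)Φ` is constant (`AsymptoticOperators`). To change the time of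
one factor of `O_1(τ) ⋯ O_n(τ)Φ` by at most `1`, move the factor to the right, next to `Φ`, change
its time there, and move it back; the error is rapidly decreasing. Summation over unit steps shows
that the vectors at common times are Cauchy, with a rate faster than any power. As the `B_j(τ, x)`
are not supposed to be differentiable in `τ`, finite differences replace derivatives in time. If the
times are different, they are made equal from right to left: the vector formed by the factors to the
right of a given one changes by less than any power of the times involved, and comparability of the
times lets this absorb the polynomial norms of the factors to the left
(`AsymptoticOperators.replace_times`).
-/

noncomputable section

namespace Scattering

/-! ### Asymptotically commuting operators and products of them applied to a vector -/

section Abstract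

/-- A function of two times is rapidly decreasing if, for times `τ, σ ≤ -1` at distance at most `1`,
it is smaller than any negative power of `|τ|`. -/
def IsRapid (F : ℝ → ℝ → ℝ) : Prop :=
  ∀ N : ℕ, ∃ C : ℝ, ∀ τ σ : ℝ, τ ≤ -1 → σ ≤ -1 → |τ - σ| ≤ 1 → F τ σ * |τ| ^ N ≤ C

lemma IsRapid.mono {F G : ℝ → ℝ → ℝ} (hG : IsRapid G)
    (h : ∀ τ σ, τ ≤ -1 → σ ≤ -1 → |τ - σ| ≤ 1 → F τ σ ≤ G τ σ) : IsRapid F := by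
  intro N
  obtain ⟨C, hC⟩ := hG N
  refine ⟨C, fun τ σ hτ hσ hd => le_trans ?_ (hC τ σ hτ hσ hd)⟩
  gcongr
  exact h τ σ hτ hσ hd

lemma IsRapid.add {F G : ℝ → ℝ → ℝ} (hF : IsRapid F) (hG : IsRapid G) :
    IsRapid fun τ σ => F τ σ + G τ σ := by
  intro N
  obtain ⟨C, hC⟩ := hF N
  obtain ⟨D, hD⟩ := hG N
  refine ⟨C + D, fun τ σ hτ hσ hd => ?_⟩
  rw [add_mul]
  exact add_le_add (hC τ σ hτ hσ hd) (hD τ σ hτ hσ hd)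

lemma IsRapid.poly_mul {F : ℝ → ℝ → ℝ} (hF : IsRapid F) (hF0 : ∀ τ σ, 0 ≤ F τ σ) (s : ℕ) (C : ℝ) :
    IsRapid fun τ σ => C * |τ| ^ s * F τ σ := by
  intro N
  obtain ⟨D, hD⟩ := hF (s + N)
  refine ⟨|C| * D, fun τ σ hτ hσ hd => ?_⟩
  calc C * |τ| ^ s * F τ σ * |τ| ^ N = C * (F τ σ * |τ| ^ (s + N)) := by ring
    _ ≤ |C| * (F τ σ * |τ| ^ (s + N)) := by
        gcongr
        · exact mul_nonneg (hF0 _ _) (by positivity)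
        · exact le_abs_self C
    _ ≤ |C| * D := by gcongr; exact hD τ σ hτ hσ hd

lemma abs_le_two_mul_abs {τ σ : ℝ} (hτ : τ ≤ -1) (hσ : σ ≤ -1) (h : |τ - σ| ≤ 1) :
    |τ| ≤ 2 * |σ| := by
  rw [abs_of_neg (by linarith), abs_of_neg (by linarith)]
  have := abs_le.1 h
  linarith

lemma IsRapid.diag {F : ℝ → ℝ → ℝ} (hF : IsRapid F) (hF0 : ∀ τ σ, 0 ≤ F τ σ) :
    IsRapid fun _ σ => F σ σ := by
  intro N
  obtain ⟨C, hC⟩ := hF N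
  refine ⟨2 ^ N * C, fun τ σ hτ hσ hd => ?_⟩
  calc F σ σ * |τ| ^ N ≤ F σ σ * (2 * |σ|) ^ N := by
        gcongr
        · exact hF0 _ _
        · exact abs_le_two_mul_abs hτ hσ hd
    _ = 2 ^ N * (F σ σ * |σ| ^ N) := by ring
    _ ≤ 2 ^ N * C := by gcongr; exact hC σ σ hσ hσ (by simp)

variable {𝕜 H : Type*} [RCLike 𝕜] [NormedAddCommGroup H] [NormedSpace 𝕜 H]

/-- The operator `Q τ` has norm at most a power of `|τ|` for `τ ≤ -1`. -/
def IsPolyBounded (Q : ℝ → H →L[𝕜] H) : Prop :=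
  ∃ (s : ℕ) (C : ℝ), ∀ τ ≤ -1, ‖Q τ‖ ≤ C * |τ| ^ s

/-- The commutators of `Q τ` and `R σ` at nearby times are rapidly decreasing. -/
def RapidlyCommute (Q R : ℝ → H →L[𝕜] H) : Prop :=
  IsRapid fun τ σ => ‖Q τ * R σ - R σ * Q τ‖

/-- The vector `O_0(t_0) ⋯ O_{n-1}(t_{n-1}) v`. -/
def prodApply {n : ℕ} (O : Fin n → ℝ → H →L[𝕜] H) (t : Fin n → ℝ) (v : H) : H :=
  (List.finRange n).foldr (fun a w => O a (t a) w) v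

@[simp] lemma prodApply_zero (O : Fin 0 → ℝ → H →L[𝕜] H) (t : Fin 0 → ℝ) (v : H) :
    prodApply O t v = v := rfl

lemma prodApply_succ {n : ℕ} (O : Fin (n + 1) → ℝ → H →L[𝕜] H) (t : Fin (n + 1) → ℝ) (v : H) :
    prodApply O t v = O 0 (t 0) (prodApply (Fin.tail O) (Fin.tail t) v) := by
  simp [prodApply, List.finRange_succ, List.foldr_map, Fin.tail]

/-- Operators `O_a(τ)` that are polynomially bounded, commute asymptotically for different labels,
and produce from `Φ` vectors independent of time. -/
structure AsymptoticOperators {ι : Type*} (O : ι → ℝ → H →L[𝕜] H) (Φ : H) : Prop where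
  bounded : ∀ a, IsPolyBounded (O a)
  commute : ∀ a b, a ≠ b → RapidlyCommute (O a) (O b)
  stationary : ∀ a τ σ, O a τ Φ = O a σ Φ

lemma AsymptoticOperators.tail {n : ℕ} {O : Fin (n + 1) → ℝ → H →L[𝕜] H} {Φ : H}
    (h : AsymptoticOperators O Φ) : AsymptoticOperators (Fin.tail O) Φ where
  bounded a := h.bounded a.succ
  commute a b hab := h.commute _ _ (by simpa using hab)
  stationary a := h.stationary a.succ

lemma prodApply_bounded {n : ℕ} {O : Fin n → ℝ → H →L[𝕜] H} (hO : ∀ a, IsPolyBounded (O a))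
    (v : H) : ∃ (s : ℕ) (C : ℝ), 0 ≤ C ∧ ∀ τ ≤ -1, ‖prodApply O (fun _ => τ) v‖ ≤ C * |τ| ^ s := by
  induction n with
  | zero => exact ⟨0, ‖v‖, norm_nonneg _, fun τ _ => by simp⟩
  | succ n ih =>
    obtain ⟨s, C, hC, hs⟩ := ih (O := Fin.tail O) fun a => hO a.succ
    obtain ⟨r, D, hD⟩ := hO 0
    refine ⟨r + s, |D| * C, by positivity, fun τ hτ => ?_⟩
    rw [prodApply_succ]
    calc _ ≤ ‖O 0 τ‖ * ‖prodApply (Fin.tail O) (fun _ => τ) v‖ := (O 0 τ).le_opNorm _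
      _ ≤ (|D| * |τ| ^ r) * (C * |τ| ^ s) := by
        gcongr
        · exact (hD τ hτ).trans (by gcongr; exact le_abs_self D)
        · exact hs τ hτ
      _ = _ := by ring

/-- An operator can be moved through a product of operators with which it commutes
asymptotically. -/
lemma IsRapid.move_through {n : ℕ} {O : Fin n → ℝ → H →L[𝕜] H} (hO : ∀ a, IsPolyBounded (O a))
    {Q : ℝ → H →L[𝕜] H} (hQO : ∀ a, RapidlyCommute Q (O a)) (v : H) :
    IsRapid fun τ σ =>
      ‖Q τ (prodApply O (fun _ => σ) v) - prodApply O (fun _ => σ) (Q τ v)‖ := by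
  induction n with
  | zero => intro N; exact ⟨0, fun τ σ _ _ _ => by simp⟩
  | succ n ih =>
    have h1 := ih (O := Fin.tail O) (fun a => hO a.succ) (fun a => hQO a.succ)
    obtain ⟨s, C, hC, hs⟩ := prodApply_bounded (O := Fin.tail O) (fun a => hO a.succ) v
    obtain ⟨r, D, hD⟩ := hO 0
    refine IsRapid.mono (((hQO 0).poly_mul (fun _ _ => norm_nonneg _) s (C * 2 ^ s)).add
      (h1.poly_mul (fun _ _ => norm_nonneg _) r (|D| * 2 ^ r))) fun τ σ hτ hσ hd => ?_
    have hστ : |σ| ≤ 2 * |τ| := abs_le_two_mul_abs hσ hτ (by rwa [abs_sub_comm])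
    rw [prodApply_succ, prodApply_succ]
    change ‖Q τ (O 0 σ (prodApply (Fin.tail O) (fun _ => σ) v))
      - O 0 σ (prodApply (Fin.tail O) (fun _ => σ) (Q τ v))‖ ≤ _
    set P := prodApply (Fin.tail O) (fun _ => σ)
    have e : Q τ (O 0 σ (P v)) - O 0 σ (P (Q τ v)) =
        (Q τ * O 0 σ - O 0 σ * Q τ) (P v) + O 0 σ (Q τ (P v) - P (Q τ v)) := by
      simp
    rw [e]
    refine (norm_add_le _ _).trans (add_le_add ?_ ?_)
    · refine (ContinuousLinearMap.le_opNorm _ _).trans ?_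
      rw [mul_comm]
      gcongr
      calc ‖P v‖ ≤ C * |σ| ^ s := hs σ hσ
        _ ≤ C * (2 * |τ|) ^ s := by gcongr
        _ = _ := by ring
    · refine (ContinuousLinearMap.le_opNorm _ _).trans ?_
      gcongr
      calc ‖O 0 σ‖ ≤ D * |σ| ^ r := hD σ hσ
        _ ≤ |D| * (2 * |τ|) ^ r := by gcongr; exact le_abs_self D
        _ = _ := by ring

/-- A small change of the common time changes the vector by a rapidly decreasing amount: the leftmost
operator is moved next to `Φ`, where its time may be changed, and back. -/
lemma AsymptoticOperators.isRapid_sub {n : ℕ} {O : Fin n → ℝ → H →L[𝕜] H} {Φ : H}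
    (h : AsymptoticOperators O Φ) :
    IsRapid fun τ σ => ‖prodApply O (fun _ => τ) Φ - prodApply O (fun _ => σ) Φ‖ := by
  induction n with
  | zero => intro N; exact ⟨0, fun τ σ _ _ _ => by simp⟩
  | succ n ih =>
    have h1 := ih h.tail
    have h2 : IsRapid fun τ σ => ‖O 0 τ (prodApply (Fin.tail O) (fun _ => σ) Φ) -
        prodApply (Fin.tail O) (fun _ => σ) (O 0 τ Φ)‖ :=
      IsRapid.move_through h.tail.bounded (fun a => h.commute 0 a.succ (Fin.succ_ne_zero a).symm) Φ
    have h3 := h2.diag fun _ _ => norm_nonneg _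
    obtain ⟨r, D, hD⟩ := h.bounded 0
    refine IsRapid.mono (((h1.poly_mul (fun _ _ => norm_nonneg _) r D).add h2).add h3)
      fun τ σ hτ hσ hd => ?_
    rw [prodApply_succ, prodApply_succ]
    change ‖O 0 τ (prodApply (Fin.tail O) (fun _ => τ) Φ) -
      O 0 σ (prodApply (Fin.tail O) (fun _ => σ) Φ)‖ ≤ _
    set P := prodApply (Fin.tail O)
    have e : O 0 τ (P (fun _ => τ) Φ) - O 0 σ (P (fun _ => σ) Φ) =
        O 0 τ (P (fun _ => τ) Φ - P (fun _ => σ) Φ) +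
        (O 0 τ (P (fun _ => σ) Φ) - P (fun _ => σ) (O 0 τ Φ)) -
        (O 0 σ (P (fun _ => σ) Φ) - P (fun _ => σ) (O 0 σ Φ)) := by
      rw [h.stationary 0 σ τ, map_sub]; abel
    rw [e]
    refine (norm_sub_le _ _).trans (add_le_add ((norm_add_le _ _).trans (add_le_add ?_ le_rfl)) le_rfl)
    refine (ContinuousLinearMap.le_opNorm _ _).trans ?_
    gcongr
    exact hD τ hτ

/-- Summation of the small changes of time: a vector-valued function whose increments over time
differences at most `1` are rapidly decreasing is Cauchy as the time tends to `-∞`, with a rapid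
rate. -/
lemma IsRapid.telescope {u : ℝ → H} (h : IsRapid fun τ σ => ‖u τ - u σ‖) (N : ℕ) :
    ∃ C : ℝ, 0 ≤ C ∧ ∀ τ σ, τ ≤ -1 → σ ≤ τ → ‖u τ - u σ‖ * |τ| ^ N ≤ C := by
  obtain ⟨C, hC⟩ := h (N + 2)
  have hC0 : 0 ≤ C := le_trans (by simp) (hC (-1) (-1) le_rfl le_rfl (by simp))
  have hsum : Summable fun k : ℕ => C * (1 / ((k : ℝ) + 1) ^ 2) := by
    apply Summable.mul_left
    exact_mod_cast (summable_nat_add_iff 1).2 (Real.summable_one_div_nat_pow.2 one_lt_two)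
  have hpos : ∀ k : ℕ, 0 ≤ C * (1 / ((k : ℝ) + 1) ^ 2) := fun k => by positivity
  have key : ∀ τ : ℝ, τ ≤ -1 → ∀ (k : ℕ) (σ : ℝ), σ ≤ τ - k → τ - k - σ ≤ 1 →
      ‖u (τ - k) - u σ‖ * |τ| ^ N ≤ C * (1 / ((k : ℝ) + 1) ^ 2) := by
    intro τ hτ k σ hσ hd
    have hk : (0 : ℝ) ≤ k := Nat.cast_nonneg k
    have h1 := hC (τ - k) σ (by linarith) (by linarith) (by rw [abs_of_nonneg] <;> linarith)
    have h2 : |τ| ≤ |τ - k| := by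
      rw [abs_of_neg (by linarith), abs_of_neg (by linarith)]; linarith
    have h3 : (k : ℝ) + 1 ≤ |τ - k| := by rw [abs_of_neg (by linarith)]; linarith
    rw [mul_one_div, le_div_iff₀ (by positivity)]
    calc ‖u (τ - k) - u σ‖ * |τ| ^ N * ((k : ℝ) + 1) ^ 2
        ≤ ‖u (τ - k) - u σ‖ * |τ - k| ^ N * |τ - k| ^ 2 := by gcongr
      _ = ‖u (τ - k) - u σ‖ * |τ - k| ^ (N + 2) := by ring
      _ ≤ C := h1
  refine ⟨∑' k : ℕ, C * (1 / ((k : ℝ) + 1) ^ 2), tsum_nonneg hpos, fun τ σ hτ hσ => ?_⟩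
  have ind : ∀ n : ℕ, ‖u τ - u (τ - n)‖ * |τ| ^ N ≤
      ∑ k ∈ Finset.range n, C * (1 / ((k : ℝ) + 1) ^ 2) := by
    intro n
    induction n with
    | zero => simp
    | succ n ih =>
      rw [Finset.sum_range_succ]
      have h1 := key τ hτ n (τ - (n + 1 : ℕ)) (by push_cast; linarith) (by push_cast; linarith)
      calc _ ≤ (‖u τ - u (τ - n)‖ + ‖u (τ - n) - u (τ - (n + 1 : ℕ))‖) * |τ| ^ N := by
            gcongr; exact norm_sub_le_norm_sub_add_norm_sub _ _ _
        _ ≤ _ := by rw [add_mul]; exact add_le_add ih h1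
  set n := ⌊τ - σ⌋₊
  have h1 : (n : ℝ) ≤ τ - σ := Nat.floor_le (by linarith)
  have h2 : τ - σ < n + 1 := Nat.lt_floor_add_one _
  calc _ ≤ (‖u τ - u (τ - n)‖ + ‖u (τ - n) - u σ‖) * |τ| ^ N := by
        gcongr; exact norm_sub_le_norm_sub_add_norm_sub _ _ _
    _ ≤ ∑ k ∈ Finset.range (n + 1), C * (1 / ((k : ℝ) + 1) ^ 2) := by
        rw [add_mul, Finset.sum_range_succ]
        exact add_le_add (ind n) (key τ hτ n σ (by linarith) (by linarith))
    _ ≤ _ := hsum.sum_le_tsum _ fun k _ => hpos k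

lemma AsymptoticOperators.cauchy_rate {n : ℕ} {O : Fin n → ℝ → H →L[𝕜] H} {Φ : H}
    (h : AsymptoticOperators O Φ) (N : ℕ) :
    ∃ C : ℝ, 0 ≤ C ∧ ∀ τ σ, τ ≤ -1 → σ ≤ -1 →
      ‖prodApply O (fun _ => τ) Φ - prodApply O (fun _ => σ) Φ‖ ≤
        C / |τ| ^ N + C / |σ| ^ N := by
  obtain ⟨C, hC0, hC⟩ := h.isRapid_sub.telescope N
  refine ⟨C, hC0, fun τ σ hτ hσ => ?_⟩
  have pos : ∀ r : ℝ, r ≤ -1 → 0 < |r| ^ N := fun r hr =>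
    pow_pos (abs_pos.2 (by linarith)) N
  rcases le_total σ τ with hle | hle
  · refine ((le_div_iff₀ (pos τ hτ)).2 (hC τ σ hτ hle)).trans ?_
    have := div_nonneg hC0 (pos σ hσ).le
    linarith
  · rw [norm_sub_rev]
    refine ((le_div_iff₀ (pos σ hσ)).2 (hC σ τ hσ hle)).trans ?_
    have := div_nonneg hC0 (pos τ hτ).le
    linarith

/-- The vectors at a common time converge as the time tends to `-∞`. -/
lemma AsymptoticOperators.exists_tendsto [CompleteSpace H] {n : ℕ} {O : Fin n → ℝ → H →L[𝕜] H}
    {Φ : H} (h : AsymptoticOperators O Φ) :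
    ∃ v : H, Tendsto (fun τ => prodApply O (fun _ => τ) Φ) atBot (𝓝 v) := by
  apply cauchy_map_iff_exists_tendsto.1
  obtain ⟨C, hC0, hC⟩ := h.cauchy_rate 1
  rw [Metric.cauchy_iff]
  refine ⟨map_neBot, fun ε hε => ?_⟩
  set T := min (-1) (-(2 * C + 1) / ε)
  refine ⟨(fun τ => prodApply O (fun _ => τ) Φ) '' Set.Iic T, image_mem_map (Iic_mem_atBot T), ?_⟩
  rintro _ ⟨τ, hτ, rfl⟩ _ ⟨σ, hσ, rfl⟩
  rw [dist_eq_norm]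
  have aux : ∀ r ∈ Set.Iic T, r ≤ -1 ∧ C / |r| ^ 1 < ε / 2 := by
    intro r hr
    have h1 : r ≤ -1 := le_trans hr (min_le_left _ _)
    refine ⟨h1, ?_⟩
    have h2 : r ≤ -(2 * C + 1) / ε := le_trans hr (min_le_right _ _)
    rw [pow_one, abs_of_neg (by linarith), div_lt_iff₀ (by linarith)]
    rw [le_div_iff₀ hε] at h2
    linarith
  have a1 := aux τ hτ
  have a2 := aux σ hσ
  have := hC τ σ a1.1 a2.1
  simp only [] at this ⊢
  linarith

/-- Under the polynomial comparability of times, all times may be replaced by the leftmost one. By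
induction the times to the right of the leftmost one may be taken equal to the second one, and a
common time may be changed; the leftmost time is at most a power of the second one, so that the
polynomial bound of the leftmost operator is absorbed. -/
lemma AsymptoticOperators.replace_times {n : ℕ} {O : Fin (n + 1) → ℝ → H →L[𝕜] H} {Φ : H}
    (h : AsymptoticOperators O Φ) (p N : ℕ) :
    ∃ C : ℝ, 0 ≤ C ∧ ∀ t ∈ comparableTimes (n + 1) p, (∀ a, t a ≤ -1) →
      ‖prodApply O t Φ - prodApply O (fun _ => t 0) Φ‖ ≤ C / |t 0| ^ N := by
  induction n generalizing N with
  | zero =>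
    exact ⟨0, le_rfl, fun t _ _ => by
      have : t = fun _ => t 0 := funext fun a => by rw [Fin.fin_one_eq_zero a]
      rw [← this]; simp⟩
  | succ n ih =>
    obtain ⟨r, D, hD⟩ := h.bounded 0
    have pos : ∀ (N : ℕ) (r : ℝ), r ≤ -1 → 0 < |r| ^ N := fun N r hr =>
      pow_pos (abs_pos.2 (by linarith)) N
    -- It suffices to bound the change of the vector to the right of the leftmost operator.
    suffices hs : ∃ C : ℝ, 0 ≤ C ∧ ∀ t ∈ comparableTimes (n + 1 + 1) p, (∀ a, t a ≤ -1) →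
        ‖prodApply (Fin.tail O) (Fin.tail t) Φ - prodApply (Fin.tail O) (fun _ => t 0) Φ‖ ≤
          C / |t 0| ^ (N + r) by
      obtain ⟨C, hC0, hC⟩ := hs
      refine ⟨|D| * C, by positivity, fun t ht ht1 => ?_⟩
      rw [prodApply_succ O t, prodApply_succ O fun _ => t 0]
      change ‖O 0 (t 0) (prodApply (Fin.tail O) (Fin.tail t) Φ) -
        O 0 (t 0) (prodApply (Fin.tail O) (fun _ => t 0) Φ)‖ ≤ _
      rw [← map_sub]
      refine (ContinuousLinearMap.le_opNorm _ _).trans ?_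
      have p1 := pos N (t 0) (ht1 0)
      have p2 := pos r (t 0) (ht1 0)
      calc _ ≤ (|D| * |t 0| ^ r) * (C / |t 0| ^ (N + r)) := by
            gcongr
            · exact (hD _ (ht1 0)).trans (by gcongr; exact le_abs_self D)
            · exact hC t ht ht1
        _ = _ := by rw [pow_add]; field_simp
    rcases Nat.eq_zero_or_pos n with rfl | hn
    · refine ⟨0, le_rfl, fun t ht ht1 => ?_⟩
      rw [prodApply_succ, prodApply_succ]
      simp [h.tail.stationary 0 (Fin.tail t 0) (t 0)]
    · obtain ⟨C, hC0, hC⟩ := ih h.tail (p * (N + r))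
      obtain ⟨C₃, hC₃0, hC₃⟩ := h.tail.isRapid_sub.telescope (N + r)
      obtain ⟨C₄, hC₄0, hC₄⟩ := h.tail.isRapid_sub.telescope (p * (N + r))
      refine ⟨C + (C₃ + C₄), by positivity, fun t ht ht1 => ?_⟩
      have ht' : Fin.tail t ∈ comparableTimes (n + 1) p := by
        intro a b hab hb
        exact ht a.succ b.succ (by simpa using hab) (by simpa using hb)
      have h1 := hC (Fin.tail t) ht' fun a => ht1 _
      have h0 : |t 0| ≤ |Fin.tail t 0| ^ p :=
        ht 0 (Fin.succ 0) (Fin.succ_pos 0) (by simp; omega)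
      have hq : |t 0| ^ (N + r) ≤ |Fin.tail t 0| ^ (p * (N + r)) := by
        rw [pow_mul]; gcongr
      have p1 := pos (N + r) (t 0) (ht1 0)
      have p2 : 0 < |Fin.tail t 0| ^ (p * (N + r)) := pos _ _ (ht1 _)
      have conv : ∀ c, 0 ≤ c → c / |Fin.tail t 0| ^ (p * (N + r)) ≤ c / |t 0| ^ (N + r) :=
        fun c hc => div_le_div_of_nonneg_left hc p1 hq
      refine (norm_sub_le_norm_sub_add_norm_sub _
        (prodApply (Fin.tail O) (fun _ => Fin.tail t 0) Φ) _).trans ?_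
      rw [add_div]
      refine add_le_add (h1.trans (conv C hC0)) ?_
      rw [add_div]
      rcases le_total (t 0) (Fin.tail t 0) with hle | hle
      · have := (le_div_iff₀ p2).2 (hC₄ (Fin.tail t 0) (t 0) (ht1 _) hle)
        have := this.trans (conv C₄ hC₄0)
        have : 0 ≤ C₃ / |t 0| ^ (N + r) := by positivity
        linarith
      · have := (le_div_iff₀ p1).2 (hC₃ (t 0) (Fin.tail t 0) (ht1 _) hle)
        rw [norm_sub_rev]
        have : 0 ≤ C₄ / |t 0| ^ (N + r) := by positivity
        linarith

/-- Convergence in the remote past, to the limit along common times. -/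
lemma AsymptoticOperators.tendsto_remotePast {n : ℕ} {O : Fin n → ℝ → H →L[𝕜] H} {Φ v : H}
    (h : AsymptoticOperators O Φ)
    (hv : Tendsto (fun τ => prodApply O (fun _ => τ) Φ) atBot (𝓝 v)) (p : ℕ) :
    Tendsto (fun t => prodApply O t Φ) (remotePast n p) (𝓝 v) := by
  cases n with
  | zero =>
    have : v = Φ := tendsto_nhds_unique hv (by simp)
    simpa [this] using tendsto_const_nhds
  | succ n =>
    obtain ⟨C, hC0, hC⟩ := h.replace_times p 1
    have hle : remotePast (n + 1) p ≤ Filter.pi fun _ => atBot := inf_le_left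
    have ht : ∀ a, Tendsto (fun t : Fin (n + 1) → ℝ => t a) (remotePast (n + 1) p) atBot :=
      fun a => (tendsto_eval_pi _ a).mono_left hle
    have h1 := hv.comp (ht 0)
    have h2 : Tendsto (fun t : Fin (n + 1) → ℝ => prodApply O t Φ - prodApply O (fun _ => t 0) Φ)
        (remotePast (n + 1) p) (𝓝 0) := by
      have h3 : Tendsto (fun t : Fin (n + 1) → ℝ => C / |t 0| ^ 1) (remotePast (n + 1) p) (𝓝 0) := by
        simp only [pow_one]
        exact (tendsto_abs_atBot_atTop.comp (ht 0)).const_div_atTop C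
      refine squeeze_zero_norm' ?_ h3
      have h4 : ∀ᶠ t in remotePast (n + 1) p, t ∈ comparableTimes (n + 1) p :=
        mem_inf_of_right (mem_principal_self _)
      have h5 : ∀ᶠ t in remotePast (n + 1) p, ∀ a, t a ≤ -1 :=
        eventually_all.2 fun a => (ht a).eventually (eventually_le_atBot (-1))
      filter_upwards [h4, h5] with t ht4 ht5 using hC t ht4 ht5
    simpa using h2.add h1

end Abstract

/-! ### Derivatives of the exponential at skew-adjoint elements -/

section ExpBounds

open scoped ContDiff

/-- Near a skew-adjoint element the exponential is bounded: `exp (-tX) exp (t(X + H))` has derivative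
`exp (-tX) H exp (t(X + H))`, and `exp (-tX)` is unitary. -/
lemma norm_exp_skewAdjoint_add_le {𝔄 : Type*} [CStarAlgebra 𝔄] {X : 𝔄} (hX : X ∈ skewAdjoint 𝔄)
    (H : 𝔄) : ‖NormedSpace.exp (X + H)‖ ≤ Real.exp ‖H‖ := by
  rcases subsingleton_or_nontrivial 𝔄 with h | h
  · rw [Subsingleton.elim (NormedSpace.exp (X + H)) 0, norm_zero]
    positivity
  let +nondep : NormedAlgebra ℚ 𝔄 := .restrictScalars ℚ ℂ 𝔄
  have hu : ∀ t : ℝ, NormedSpace.exp (t • (-X)) ∈ unitary 𝔄 := fun t =>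
    NormedSpace.exp_mem_unitary_of_mem_skewAdjoint
      (by rw [skewAdjoint.mem_iff] at hX ⊢; simp [hX])
  set w : ℝ → 𝔄 := fun t => NormedSpace.exp (t • (-X)) * NormedSpace.exp (t • (X + H))
  set w' : ℝ → 𝔄 := fun t => NormedSpace.exp (t • (-X)) * (H * NormedSpace.exp (t • (X + H)))
  have hw : ∀ t, HasDerivAt w (w' t) t := fun t => by
    have := (hasDerivAt_exp_smul_const (-X) t).mul (hasDerivAt_exp_smul_const' (X + H) t)
    convert! this using 1
    simp only [w']
    noncomm_ring
  have hnorm : ∀ t, ‖w t‖ = ‖NormedSpace.exp (t • (X + H))‖ := fun t =>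
    CStarRing.norm_mem_unitary_mul _ (hu t)
  have hb : ∀ t, ‖w' t‖ ≤ ‖H‖ * ‖w t‖ + 0 := fun t => by
    rw [hnorm, add_zero]
    exact (CStarRing.norm_mem_unitary_mul _ (hu t)).trans_le (norm_mul_le _ _)
  have := norm_le_gronwallBound_of_norm_deriv_right_le (f := w) (f' := w') (δ := 1) (K := ‖H‖)
    (ε := 0) (a := 0) (b := 1) (fun t _ => (hw t).continuousAt.continuousWithinAt)
    (fun t _ => (hw t).hasDerivWithinAt) (by simp [w]) (fun t _ => hb t) 1 (by simp)
  rw [hnorm, gronwallBound_ε0] at this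
  simpa using this

/-- Cauchy's estimate for the Fréchet derivative. -/
lemma norm_fderiv_le_of_forall_mem_closedBall {V W : Type*} [NormedAddCommGroup V] [NormedSpace ℂ V]
    [NormedAddCommGroup W] [NormedSpace ℂ W] {f : V → W} (hf : Differentiable ℂ f) {x : V} {r M : ℝ}
    (hr : 0 < r) (hM : ∀ y ∈ Metric.closedBall x r, ‖f y‖ ≤ M) : ‖fderiv ℂ f x‖ ≤ M / r := by
  have hM0 : 0 ≤ M := (norm_nonneg _).trans (hM x (Metric.mem_closedBall_self hr.le))
  refine ContinuousLinearMap.opNorm_le_bound _ (by positivity) fun h => ?_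
  rcases eq_or_ne h 0 with rfl | hh
  · simp
  have hh' : 0 < ‖h‖ := norm_pos_iff.2 hh
  have hline : ∀ z : ℂ, HasDerivAt (fun z : ℂ => x + z • h) h z := fun z => by
    simpa using ((hasDerivAt_id z).smul_const h).const_add x
  have hg : ∀ z : ℂ, HasDerivAt (fun z : ℂ => f (x + z • h)) (fderiv ℂ f (x + z • h) h) z :=
    fun z => (hf _).hasFDerivAt.comp_hasDerivAt z (hline z)
  have hgd : Differentiable ℂ fun z : ℂ => f (x + z • h) := fun z => (hg z).differentiableAt
  have h1 := Complex.norm_deriv_le_of_forall_mem_sphere_norm_le (c := 0) (R := r / ‖h‖) (C := M)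
    (f := fun z : ℂ => f (x + z • h)) (by positivity) hgd.diffContOnCl fun z hz => by
      apply hM
      rw [mem_sphere_zero_iff_norm] at hz
      rw [mem_closedBall_iff_norm, add_sub_cancel_left, norm_smul, hz, div_mul_cancel₀ _ hh'.ne']
  rw [(hg 0).deriv, zero_smul, add_zero] at h1
  refine h1.trans (le_of_eq ?_)
  field_simp

/-- Cauchy's estimates for higher derivatives, with unspecified constants. -/
lemma exists_norm_iteratedFDeriv_le {V W : Type} [NormedAddCommGroup V] [NormedSpace ℂ V]
    [NormedAddCommGroup W] [NormedSpace ℂ W] (n : ℕ) {r : ℝ} (hr : 0 < r) :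
    ∃ C : ℝ, ∀ (f : V → W), ContDiff ℂ ∞ f → ∀ (x : V) (M : ℝ),
      (∀ y ∈ Metric.closedBall x r, ‖f y‖ ≤ M) → ‖iteratedFDeriv ℂ n f x‖ ≤ C * M := by
  induction n generalizing W r with
  | zero =>
    exact ⟨1, fun f _ x M hM => by simpa using hM x (Metric.mem_closedBall_self hr.le)⟩
  | succ n ih =>
    obtain ⟨C, hC⟩ := ih (W := V →L[ℂ] W) (half_pos hr)
    refine ⟨C * (r / 2)⁻¹, fun f hf x M hM => ?_⟩
    rw [← norm_iteratedFDeriv_fderiv, mul_assoc, inv_mul_eq_div]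
    refine hC (fderiv ℂ f) (hf.fderiv_right (by simp)) x _ fun y hy => ?_
    refine norm_fderiv_le_of_forall_mem_closedBall (hf.differentiable (by simp)) (half_pos hr)
      fun z hz => hM z ?_
    rw [Metric.mem_closedBall] at *
    linarith [dist_triangle z y x]

/-- All derivatives of the exponential are bounded on the set of skew-adjoint elements. -/
lemma exists_norm_iteratedFDeriv_exp_le (𝔄 : Type) [CStarAlgebra 𝔄] (n : ℕ) :
    ∃ C : ℝ, ∀ X ∈ skewAdjoint 𝔄, ‖iteratedFDeriv ℝ n (NormedSpace.exp : 𝔄 → 𝔄) X‖ ≤ C := by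
  have hexp : ContDiff ℂ ∞ (NormedSpace.exp : 𝔄 → 𝔄) :=
    AnalyticOnNhd.contDiff fun x _ => NormedSpace.exp_analytic x
  obtain ⟨C, hC⟩ := exists_norm_iteratedFDeriv_le (V := 𝔄) (W := 𝔄) n one_pos
  refine ⟨C * Real.exp 1, fun X hX => ?_⟩
  rw [← ContDiffAt.restrictScalars_iteratedFDeriv (𝕜 := ℝ) (𝕜' := ℂ)
    ((hexp.of_le (by exact_mod_cast le_top)).contDiffAt), Function.comp_apply,
    ContinuousMultilinearMap.norm_restrictScalars]
  refine hC _ hexp X _ fun Y hY => ?_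
  have := norm_exp_skewAdjoint_add_le hX (Y - X)
  rw [add_sub_cancel] at this
  refine this.trans (Real.exp_le_exp.2 ?_)
  rwa [mem_closedBall_iff_norm] at hY

open scoped Matrix.Norms.L2Operator Nat in
/-- Each derivative of `exp(iτE)` with respect to the momentum costs one power of `τ`; the growth in
the momentum is polynomial. -/
lemma exists_norm_iteratedFDeriv_exp_comp_le {V : Type*} [NormedAddCommGroup V] [NormedSpace ℝ V]
    {m : ℕ} {G : V → Matrix (Fin m) (Fin m) ℂ} (hG : ∀ k, (G k).IsHermitian)
    (hgrowth : G.HasTemperateGrowth) (n : ℕ) :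
    ∃ (C : ℝ) (s : ℕ), 0 ≤ C ∧ ∀ (τ : ℝ) (k : V), ∀ i ≤ n,
      ‖iteratedFDeriv ℝ i (fun k => NormedSpace.exp ((Complex.I * (τ : ℂ)) • G k)) k‖ ≤
        C * (1 + |τ|) ^ n * (1 + ‖k‖) ^ s := by
  choose c hc using exists_norm_iteratedFDeriv_exp_le (Matrix (Fin m) (Fin m) ℂ)
  obtain ⟨s, C, hC0, hC⟩ := hgrowth.norm_iteratedFDeriv_le_uniform n
  set c' : ℝ := ∑ i ∈ Finset.range (n + 1), |c i|
  have hc' : 0 ≤ c' := Finset.sum_nonneg fun _ _ => abs_nonneg _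
  refine ⟨n ! * c' * (1 + C) ^ n, s * n, by positivity, fun τ k i hi => ?_⟩
  have hskew : ∀ k, (Complex.I * (τ : ℂ)) • G k ∈ skewAdjoint (Matrix (Fin m) (Fin m) ℂ) := by
    intro k
    rw [skewAdjoint.mem_iff, star_smul, Matrix.star_eq_conjTranspose, (hG k).eq]
    simp
  have hexp : ContDiff ℝ ∞ (NormedSpace.exp : Matrix (Fin m) (Fin m) ℂ → _) :=
    AnalyticOnNhd.contDiff fun x _ => NormedSpace.exp_analytic (𝕂 := ℝ) x
  set D : ℝ := (1 + C) * (1 + |τ|) * (1 + ‖k‖) ^ s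
  have hD : 1 ≤ D := by
    have h1 : (1 : ℝ) ≤ 1 + C := by linarith
    have h2 : (1 : ℝ) ≤ 1 + |τ| := by linarith [abs_nonneg τ]
    have h3 : (1 : ℝ) ≤ (1 + ‖k‖) ^ s := one_le_pow₀ (by linarith [norm_nonneg k])
    exact one_le_mul_of_one_le_of_one_le (one_le_mul_of_one_le_of_one_le h1 h2) h3
  have h1 : ∀ j, 1 ≤ j → j ≤ i →
      ‖iteratedFDeriv ℝ j (fun k => (Complex.I * (τ : ℂ)) • G k) k‖ ≤ D ^ j := by
    intro j hj hji
    have e : iteratedFDeriv ℝ j (fun k => (Complex.I * (τ : ℂ)) • G k) k =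
        (Complex.I * (τ : ℂ)) • iteratedFDeriv ℝ j G k :=
      iteratedFDeriv_const_smul_apply' (hgrowth.1.contDiffAt.of_le (by exact_mod_cast le_top))
    rw [e, norm_smul]
    calc _ ≤ |τ| * (C * (1 + ‖k‖) ^ s) := by
          gcongr
          · simp
          · exact hC j (hji.trans hi) k
      _ ≤ (1 + |τ|) * ((1 + C) * (1 + ‖k‖) ^ s) := by gcongr <;> linarith
      _ = D := by simp only [D]; ring
      _ ≤ D ^ j := le_self_pow₀ hD (by omega)
  have h2 : ∀ j, j ≤ i →
      ‖iteratedFDeriv ℝ j (NormedSpace.exp : Matrix (Fin m) (Fin m) ℂ → _)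
        ((fun k => (Complex.I * (τ : ℂ)) • G k) k)‖ ≤ c' := by
    intro j hj
    refine (hc j _ (hskew k)).trans ((le_abs_self _).trans ?_)
    exact Finset.single_le_sum (f := fun i => |c i|) (fun _ _ => abs_nonneg _)
      (Finset.mem_range.2 (by omega))
  refine (norm_iteratedFDeriv_comp_le hexp (hgrowth.1.const_smul _)
    (by exact_mod_cast le_top) k h2 h1).trans ?_
  calc (i ! : ℝ) * c' * D ^ i ≤ n ! * c' * D ^ n := by gcongr
    _ = _ := by simp only [D]; rw [mul_pow, mul_pow, ← pow_mul]; ring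

end ExpBounds

/-! ### The waves -/

section Waves

variable {𝕜 : Type*} [RCLike 𝕜] {d m : ℕ} {E : Space d → Matrix (Fin m) (Fin m) ℂ}

/-- The dilation `ξ ↦ 2πξ` that relates the momentum `k` to the frequency `ξ = k / 2π`. -/
def toMomentum (d : ℕ) : Space d ≃L[ℝ] Space d :=
  ContinuousLinearEquiv.smulLeft (Units.mk0 (2 * Real.pi) (by positivity))

lemma toMomentum_apply (ξ : Space d) : toMomentum d ξ = (2 * Real.pi) • ξ := rfl

/-- An entry of the matrix `exp(iτE(k))` as a function of the frequency `ξ = k / 2π`. -/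
def evolEntry (E : Space d → Matrix (Fin m) (Fin m) ℂ) (τ : ℝ) (a b : Fin m) (ξ : Space d) : ℂ :=
  evol E τ (toMomentum d ξ) a b

open scoped Matrix.Norms.L2Operator ContDiff in
lemma IsDispersion.evolEntry_bound (hE : IsDispersion 𝕜 E) (n : ℕ) :
    ∃ (C : ℝ) (s : ℕ), 0 ≤ C ∧ ∀ (τ : ℝ) (ξ : Space d) (a b : Fin m), ∀ i ≤ n,
      ContDiff ℝ ∞ (evolEntry E τ a b) ∧
      ‖iteratedFDeriv ℝ i (evolEntry E τ a b) ξ‖ ≤ C * (1 + |τ|) ^ n * (1 + ‖ξ‖) ^ s := by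
  set G : Space d → Matrix (Fin m) (Fin m) ℂ := fun ξ => E (toMomentum d ξ)
  have hG : G.HasTemperateGrowth := by
    have e : G = fun ξ => ∑ a, ∑ b, E (toMomentum d ξ) a b • Matrix.single a b (1 : ℂ) := by
      funext ξ
      conv_lhs => rw [Matrix.matrix_eq_sum_single (G ξ)]
      simp [G, Matrix.smul_single]
    rw [e]
    refine Function.HasTemperateGrowth.sum fun a _ =>
      Function.HasTemperateGrowth.sum fun b _ => ?_
    exact ((hE.growth a b).comp (toMomentum d).hasTemperateGrowth).fun_smul (.const _)
  have hG' : ∀ ξ, (G ξ).IsHermitian := fun ξ => hE.hermitian _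
  obtain ⟨C, s, hC0, hC⟩ := exists_norm_iteratedFDeriv_exp_comp_le hG' hG n
  set F : ℝ → Space d → Matrix (Fin m) (Fin m) ℂ :=
    fun τ ξ => NormedSpace.exp ((Complex.I * (τ : ℂ)) • G ξ)
  have hF : ∀ τ, ContDiff ℝ ∞ (F τ) := fun τ => by
    have hexp : ContDiff ℝ ∞ (NormedSpace.exp : Matrix (Fin m) (Fin m) ℂ → _) :=
      AnalyticOnNhd.contDiff fun x _ => NormedSpace.exp_analytic (𝕂 := ℝ) x
    exact hexp.comp (hG.1.const_smul _)
  set e : Fin m → Fin m → Matrix (Fin m) (Fin m) ℂ →L[ℝ] ℂ := fun a b =>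
    LinearMap.toContinuousLinearMap (Matrix.entryLinearMap ℝ ℂ a b)
  set K : ℝ := ∑ a, ∑ b, ‖e a b‖
  have hK : ∀ a b, ‖e a b‖ ≤ K := fun a b =>
    (Finset.single_le_sum (f := fun b => ‖e a b‖) (fun _ _ => norm_nonneg _)
      (Finset.mem_univ b)).trans
    (Finset.single_le_sum (f := fun a => ∑ b, ‖e a b‖)
      (fun _ _ => Finset.sum_nonneg fun _ _ => norm_nonneg _) (Finset.mem_univ a))
  have hK0 : 0 ≤ K := Finset.sum_nonneg fun _ _ => Finset.sum_nonneg fun _ _ => norm_nonneg _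
  have hcomp : ∀ τ a b, evolEntry E τ a b = e a b ∘ F τ := fun τ a b => rfl
  refine ⟨K * C, s, by positivity, fun τ ξ a b i hi => ⟨?_, ?_⟩⟩
  · rw [hcomp]; exact (e a b).contDiff.comp (hF τ)
  · rw [hcomp]
    refine ((e a b).norm_iteratedFDeriv_comp_left (hF τ).contDiffAt
      (by exact_mod_cast le_top)).trans ?_
    calc _ ≤ K * (C * (1 + |τ|) ^ n * (1 + ‖ξ‖) ^ s) := by
          gcongr
          · exact hK a b
          · exact hC τ ξ i hi
      _ = _ := by ring

lemma IsDispersion.evolEntry_hasTemperateGrowth (hE : IsDispersion 𝕜 E) (τ : ℝ) (a b : Fin m) :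
    (evolEntry E τ a b).HasTemperateGrowth := by
  refine ⟨?_, fun n => ?_⟩
  · obtain ⟨C, s, -, h⟩ := hE.evolEntry_bound 0
    exact (h τ 0 a b 0 le_rfl).1
  · obtain ⟨C, s, -, h⟩ := hE.evolEntry_bound n
    exact ⟨s, C * (1 + |τ|) ^ n, fun ξ => (h τ ξ a b n le_rfl).2⟩

/-- A Schwartz function of the momentum as a function of the frequency. -/
def rescale (u : 𝓢(Space d, ℂ)) : 𝓢(Space d, ℂ) :=
  SchwartzMap.compCLMOfContinuousLinearEquiv ℂ (toMomentum d) u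

/-- The component `j` of `exp(iτE) f`, as a Schwartz function of the frequency. -/
def symbol (E : Space d → Matrix (Fin m) (Fin m) ℂ) (f : Family d m) (τ : ℝ) (j : Fin m) :
    𝓢(Space d, ℂ) :=
  ∑ i, SchwartzMap.smulLeftCLM ℂ (evolEntry E τ j i) (rescale (f i))

lemma IsDispersion.symbol_apply (hE : IsDispersion 𝕜 E) (f : Family d m) (τ : ℝ) (j : Fin m)
    (ξ : Space d) : symbol E f τ j ξ = ∑ i, evolEntry E τ j i ξ * f i (toMomentum d ξ) := by
  simp only [symbol, sum_apply]
  refine Finset.sum_congr rfl fun i _ => ?_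
  rw [SchwartzMap.smulLeftCLM_apply_apply (hE.evolEntry_hasTemperateGrowth τ j i)]
  rfl

lemma IsDispersion.wave_eq (hE : IsDispersion 𝕜 E) (f : Family d m) (τ : ℝ) (j : Fin m) :
    wave E f τ j = 𝓕 (symbol E f τ j) := by
  have : (symbol E f τ j : Space d → ℂ) = fun ξ : Space d =>
      (evol E τ ((2 * Real.pi) • ξ)).mulVec (fun i => f i ((2 * Real.pi) • ξ)) j := by
    funext ξ
    rw [hE.symbol_apply]
    rfl
  rw [SchwartzMap.fourier_coe, this]
  rfl

open scoped ContDiff in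
lemma IsDispersion.symbol_bound (hE : IsDispersion 𝕜 E) (f : Family d m) (n r : ℕ) :
    ∃ C : ℝ, 0 ≤ C ∧ ∀ (τ : ℝ) (ξ : Space d) (j : Fin m), ∀ i ≤ n,
      (1 + ‖ξ‖) ^ r * ‖iteratedFDeriv ℝ i (symbol E f τ j) ξ‖ ≤ C * (1 + |τ|) ^ n := by
  obtain ⟨C, s, hC0, hC⟩ := hE.evolEntry_bound n
  set K : Fin m → ℝ := fun l => 2 ^ (s + r) *
    (Finset.Iic ((s + r : ℕ), n)).sup (fun m => SchwartzMap.seminorm ℂ m.1 m.2) (rescale (f l))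
  have hK : ∀ l, ∀ i ≤ n, ∀ ξ, (1 + ‖ξ‖) ^ (s + r) * ‖iteratedFDeriv ℝ i (rescale (f l)) ξ‖ ≤ K l :=
    fun l i hi ξ => SchwartzMap.one_add_le_sup_seminorm_apply (𝕜 := ℂ) (m := (s + r, n)) le_rfl hi
      (rescale (f l)) ξ
  have hK0 : ∀ l, 0 ≤ K l := fun l =>
    le_trans (by positivity) (hK l 0 (Nat.zero_le _) 0)
  refine ⟨∑ l, 2 ^ n * C * K l, Finset.sum_nonneg fun l _ => by have := hK0 l; positivity,
    fun τ ξ j i hi => ?_⟩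
  have e : (symbol E f τ j : Space d → ℂ) =
      fun ξ => ∑ l, evolEntry E τ j l ξ • rescale (f l) ξ := by
    funext ξ; rw [hE.symbol_apply]; rfl
  have hsm : ∀ l, ContDiff ℝ ∞ (evolEntry E τ j l) := fun l => (hC τ ξ j l 0 (Nat.zero_le _)).1
  rw [e, iteratedFDeriv_fun_sum_apply (f := fun l ξ => evolEntry E τ j l ξ • rescale (f l) ξ) fun l _ =>
    ((hsm l).smul ((rescale (f l)).smooth ⊤)).contDiffAt.of_le (by exact_mod_cast le_top),
    Finset.sum_mul]
  refine (mul_le_mul_of_nonneg_left (norm_sum_le _ _) (by positivity)).trans ?_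
  rw [Finset.mul_sum]
  refine Finset.sum_le_sum fun l _ => ?_
  refine (mul_le_mul_of_nonneg_left (norm_iteratedFDeriv_smul_le (hsm l)
    ((rescale (f l)).smooth ⊤) ξ (n := i) (by exact_mod_cast le_top)) (by positivity)).trans ?_
  rw [Finset.mul_sum]
  have hsum : (∑ q ∈ Finset.range (i + 1), (i.choose q : ℝ)) ≤ 2 ^ n := by
    rw [← Nat.cast_sum, Nat.sum_range_choose]
    push_cast
    exact pow_le_pow_right₀ one_le_two hi
  calc _ ≤ ∑ q ∈ Finset.range (i + 1), (i.choose q : ℝ) * (C * (1 + |τ|) ^ n * K l) := by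
        refine Finset.sum_le_sum fun q hq => ?_
        have hq' : q ≤ i := Nat.lt_succ_iff.1 (Finset.mem_range.1 hq)
        have h1 := (hC τ ξ j l q (hq'.trans hi)).2
        have h2 := hK l (i - q) ((Nat.sub_le _ _).trans hi) ξ
        calc _ ≤ (1 + ‖ξ‖) ^ r * ((i.choose q : ℝ) * (C * (1 + |τ|) ^ n * (1 + ‖ξ‖) ^ s) *
              ‖iteratedFDeriv ℝ (i - q) (rescale (f l)) ξ‖) := by gcongr
          _ = (i.choose q : ℝ) * (C * (1 + |τ|) ^ n *
              ((1 + ‖ξ‖) ^ (s + r) * ‖iteratedFDeriv ℝ (i - q) (rescale (f l)) ξ‖)) := by ring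
          _ ≤ _ := by gcongr
    _ = (∑ q ∈ Finset.range (i + 1), (i.choose q : ℝ)) * (C * (1 + |τ|) ^ n * K l) := by
        rw [Finset.sum_mul]
    _ ≤ 2 ^ n * (C * (1 + |τ|) ^ n * K l) := by
        have := hK0 l
        gcongr
    _ = _ := by ring

/-- The weight `(1 + |x|)^{-(d+1)}`, an integrable function on `ℝ^d`. -/
def weight (x : Space d) : ℝ := ((1 + ‖x‖) ^ (d + 1))⁻¹

lemma weight_nonneg (x : Space d) : 0 ≤ weight x := by unfold weight; positivity

lemma integrable_weight : Integrable (weight : Space d → ℝ) := by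
  have := integrable_one_add_norm (E := Space d) (μ := volume) (r := (d + 1 : ℕ)) (by simp)
  refine this.congr (.of_forall fun x => ?_)
  simp only [weight]
  rw [Real.rpow_neg (by positivity), Real.rpow_natCast]

/-- Decay of the waves: each power of `|x|` costs one power of `|τ|`. In other words, the velocities
`x / τ` are bounded up to rapidly decreasing errors. -/
lemma IsDispersion.wave_bound (hE : IsDispersion 𝕜 E) (f : Family d m) (N : ℕ) :
    ∃ C : ℝ, 0 ≤ C ∧ ∀ (τ : ℝ) (x : Space d) (j : Fin m),
      (1 + ‖x‖) ^ N * ‖wave E f τ j x‖ ≤ C * (1 + |τ|) ^ N := by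
  obtain ⟨C, hC0, hC⟩ := hE.symbol_bound f N (d + 1)
  set I : ℝ := ∫ x : Space d, weight x
  have hI : 0 ≤ I := integral_nonneg weight_nonneg
  have key : ∀ n ≤ N, ∀ (τ : ℝ) (x : Space d) (j : Fin m),
      ‖x‖ ^ n * ‖wave E f τ j x‖ ≤ 2 ^ N * ((N + 1) * (C * (1 + |τ|) ^ N * I)) := by
    intro n hn τ x j
    have h := Real.pow_mul_norm_iteratedFDeriv_fourier_le (f := symbol E f τ j) (K := ⊤) (N := ⊤)
      ((symbol E f τ j).smooth ⊤)
      (fun k n _ _ => SchwartzMap.integrable_pow_mul_iteratedFDeriv volume (symbol E f τ j) k n)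
      (k := 0) (n := n) le_top le_top x
    simp only [norm_iteratedFDeriv_zero, pow_zero, one_mul, CharP.cast_eq_zero, mul_zero,
      zero_add, Finset.range_one, Finset.singleton_product, Finset.sum_map,
      Function.Embedding.coeFn_mk] at h
    rw [hE.wave_eq, SchwartzMap.fourier_coe]
    refine h.trans ?_
    have hint : ∀ i ∈ Finset.range (n + 1),
        ∫ v : Space d, ‖iteratedFDeriv ℝ i (symbol E f τ j) v‖ ≤ C * (1 + |τ|) ^ N * I := by
      intro i hi
      rw [← integral_const_mul]
      refine integral_mono_of_nonneg (.of_forall fun _ => norm_nonneg _)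
        (integrable_weight.const_mul _) (.of_forall fun ξ => ?_)
      have := hC τ ξ j i (by have := Finset.mem_range.1 hi; omega)
      simp only [weight]
      rwa [← div_eq_mul_inv, le_div_iff₀ (by positivity), mul_comm]
    have h12 : (2 : ℝ) ^ n ≤ 2 ^ N := pow_le_pow_right₀ one_le_two hn
    refine mul_le_mul h12 ?_ (Finset.sum_nonneg fun _ _ => integral_nonneg fun _ => norm_nonneg _)
      (by positivity)
    refine (Finset.sum_le_sum hint).trans ?_
    rw [Finset.sum_const, Finset.card_range, nsmul_eq_mul]
    have : (0 : ℝ) ≤ C * (1 + |τ|) ^ N * I := by positivity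
    push_cast
    gcongr
  refine ⟨2 ^ N * (2 * (2 ^ N * ((N + 1) * (C * I)))), by positivity, fun τ x j => ?_⟩
  have h0 := key 0 (Nat.zero_le _) τ x j
  have hN := key N le_rfl τ x j
  rw [pow_zero, one_mul] at h0
  have hp : (1 + ‖x‖) ^ N ≤ 2 ^ N * (1 + ‖x‖ ^ N) := by
    refine (add_pow_le zero_le_one (norm_nonneg x) N).trans ?_
    rw [one_pow]
    gcongr
    · exact one_le_two
    · omega
  calc _ ≤ 2 ^ N * (1 + ‖x‖ ^ N) * ‖wave E f τ j x‖ := by gcongr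
    _ = 2 ^ N * (‖wave E f τ j x‖ + ‖x‖ ^ N * ‖wave E f τ j x‖) := by ring
    _ ≤ 2 ^ N * (2 ^ N * ((N + 1) * (C * (1 + |τ|) ^ N * I)) +
        2 ^ N * ((N + 1) * (C * (1 + |τ|) ^ N * I))) := by gcongr
    _ = _ := by ring

lemma IsDispersion.continuous_wave (hE : IsDispersion 𝕜 E) (f : Family d m) (τ : ℝ) (j : Fin m) :
    Continuous (wave E f τ j) := by
  rw [hE.wave_eq]; exact (𝓕 (symbol E f τ j)).continuous

/-- The waves are integrable, with a bound that grows like a power of the time. -/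
lemma IsDispersion.norm_wave_le_weight (hE : IsDispersion 𝕜 E) (f : Family d m) :
    ∃ C : ℝ, 0 ≤ C ∧ ∀ (τ : ℝ) (x : Space d) (j : Fin m),
      ‖wave E f τ j x‖ ≤ C * (1 + |τ|) ^ (d + 1) * weight x := by
  obtain ⟨C, hC0, hC⟩ := hE.wave_bound f (d + 1)
  refine ⟨C, hC0, fun τ x j => ?_⟩
  rw [weight, ← div_eq_mul_inv, le_div_iff₀ (by positivity), mul_comm]
  exact hC τ x j

end Waves

/-! ### Translations and bounded elements in the GNS representation -/

section GNSOperators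

variable {𝕜 A : Type*} [RCLike 𝕜] [Ring A] [Algebra 𝕜 A] [StarRing A] [StarModule 𝕜 A]
variable (ω : PosFunctional 𝕜 A)

lemma extendOp_vec {L : A →ₗ[𝕜] A} (h : InducesBounded ω L) (a : A) :
    extendOp ω L (vec ω a) = vec ω (L a) := by
  rw [extendOp, dif_pos h, vec, ContinuousLinearMap.completion_apply_coe]
  rfl

lemma ext_vec {S R : GNS ω →L[𝕜] GNS ω} (h : ∀ a, S (vec ω a) = R (vec ω a)) : S = R := by
  ext v
  induction v using UniformSpace.Completion.induction_on with
  | hp => exact isClosed_eq S.continuous R.continuous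
  | ih a => exact h ((toPre ω).symm a)

lemma rep_vec {a : A} (h : IsBoundedElement ω a) (b : A) : rep ω a (vec ω b) = vec ω (a * b) :=
  extendOp_vec ω h b

variable {d : ℕ} (T : TranslationAction 𝕜 A d)

omit [StarModule 𝕜 A] in
lemma shift_shift (τ σ : ℝ) (x y : Space d) (a : A) :
    shift T τ x (shift T σ y a) = shift T (τ + σ) (x + y) a := by
  simp only [shift]
  rw [← Prod.mk_add_mk, ofAdd_add, map_mul]
  rfl

omit [StarModule 𝕜 A] in
lemma shift_zero (a : A) : shift T 0 0 a = a := by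
  simp only [shift]
  rw [Prod.mk_zero_zero, ofAdd_zero, map_one]
  rfl

omit [StarModule 𝕜 A] in
lemma shift_mul (τ : ℝ) (x : Space d) (a b : A) :
    shift T τ x (a * b) = shift T τ x a * shift T τ x b := map_mul _ _ _

variable {ω T}

lemma IsInvariantState.norm_shift (hinv : IsInvariantState ω T) (τ : ℝ) (x : Space d) (a : A) :
    ‖toPre ω (shift T τ x a)‖ = ‖toPre ω a‖ := by
  have h : ∀ b : A, ‖toPre ω b‖ ^ 2 = RCLike.re (ω.toFun (star b * b)) := fun b =>
    norm_sq_eq_re_inner (𝕜 := 𝕜) (toPre ω b)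
  rw [← sq_eq_sq₀ (norm_nonneg _) (norm_nonneg _), h, h]
  have : star (shift T τ x a) * shift T τ x a = shift T τ x (star a * a) := by
    rw [shift_mul, shift, shift, map_star]
  rw [this, hinv]

lemma IsInvariantState.inducesBounded (hinv : IsInvariantState ω T) (τ : ℝ) (x : Space d) :
    InducesBounded ω (T (Multiplicative.ofAdd (τ, x))).toAlgEquiv.toLinearMap :=
  ⟨1, fun a => by rw [one_mul]; exact (hinv.norm_shift τ x a).le⟩

lemma IsInvariantState.translateOp_vec (hinv : IsInvariantState ω T) (τ : ℝ) (x : Space d) (a : A) :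
    translateOp ω T τ x (vec ω a) = vec ω (shift T τ x a) :=
  extendOp_vec ω (hinv.inducesBounded τ x) a

lemma IsInvariantState.translateOp_mul (hinv : IsInvariantState ω T) (τ σ : ℝ) (x y : Space d) :
    translateOp ω T τ x * translateOp ω T σ y = translateOp ω T (τ + σ) (x + y) :=
  ext_vec ω fun a => by
    rw [mul_apply_eq_comp, hinv.translateOp_vec, hinv.translateOp_vec,
      hinv.translateOp_vec, shift_shift]

lemma IsInvariantState.translateOp_zero (hinv : IsInvariantState ω T) :
    translateOp ω T 0 0 = 1 :=
  ext_vec ω fun a => by rw [hinv.translateOp_vec, shift_zero]; rfl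

lemma IsInvariantState.norm_translateOp_le (hinv : IsInvariantState ω T) (τ : ℝ) (x : Space d) :
    ‖translateOp ω T τ x‖ ≤ 1 := by
  refine ContinuousLinearMap.opNorm_le_bound _ zero_le_one fun v => ?_
  rw [one_mul]
  induction v using UniformSpace.Completion.induction_on with
  | hp => exact isClosed_le (translateOp ω T τ x).continuous.norm continuous_norm
  | ih a =>
    have := hinv.translateOp_vec τ x ((toPre ω).symm a)
    simp only [vec, LinearEquiv.apply_symm_apply] at this
    rw [this, UniformSpace.Completion.norm_coe, UniformSpace.Completion.norm_coe]
    exact (hinv.norm_shift τ x _).le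

lemma IsBoundedElement.shift (hinv : IsInvariantState ω T) {a : A} (ha : IsBoundedElement ω a)
    (τ : ℝ) (x : Space d) : IsBoundedElement ω (shift T τ x a) := by
  obtain ⟨C, hC⟩ := ha
  refine ⟨C, fun b => ?_⟩
  have e : Scattering.shift T τ x a * b =
      Scattering.shift T τ x (a * Scattering.shift T (-τ) (-x) b) := by
    rw [shift_mul, shift_shift, add_neg_cancel, add_neg_cancel, shift_zero]
  rw [LinearMap.mulLeft_apply, e, hinv.norm_shift, ← hinv.norm_shift (-τ) (-x) b]
  exact hC _

lemma IsInvariantState.rep_shift (hinv : IsInvariantState ω T) {a : A} (ha : IsBoundedElement ω a)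
    (τ : ℝ) (x : Space d) :
    rep ω (shift T τ x a) = translateOp ω T τ x * rep ω a * translateOp ω T (-τ) (-x) :=
  ext_vec ω fun b => by
    rw [rep_vec ω (ha.shift hinv τ x), mul_apply_eq_comp, mul_apply_eq_comp,
      hinv.translateOp_vec, rep_vec ω ha, hinv.translateOp_vec, shift_mul, shift_shift,
      add_neg_cancel, add_neg_cancel, shift_zero]

lemma IsInvariantState.norm_conj_le (hinv : IsInvariantState ω T) (S : GNS ω →L[𝕜] GNS ω)
    (τ : ℝ) (x : Space d) :
    ‖translateOp ω T τ x * S * translateOp ω T (-τ) (-x)‖ ≤ ‖S‖ := by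
  calc _ ≤ ‖translateOp ω T τ x‖ * ‖S‖ * ‖translateOp ω T (-τ) (-x)‖ :=
        (norm_mul_le _ _).trans (by gcongr; exact norm_mul_le _ _)
    _ ≤ 1 * ‖S‖ * 1 := by gcongr <;> exact hinv.norm_translateOp_le _ _
    _ = _ := by ring

lemma IsInvariantState.norm_rep_shift_le (hinv : IsInvariantState ω T) {a : A}
    (ha : IsBoundedElement ω a) (τ : ℝ) (x : Space d) : ‖rep ω (shift T τ x a)‖ ≤ ‖rep ω a‖ := by
  rw [hinv.rep_shift ha]; exact hinv.norm_conj_le _ τ x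

/-- The norm of a commutator of translated elements depends only on the relative translation. -/
lemma IsInvariantState.norm_commutator_le (hinv : IsInvariantState ω T) {a b : A}
    (ha : IsBoundedElement ω a) (hb : IsBoundedElement ω b) (τ σ : ℝ) (x y : Space d) :
    ‖rep ω (shift T τ x a) * rep ω (shift T σ y b) - rep ω (shift T σ y b) * rep ω (shift T τ x a)‖
      ≤ ‖rep ω (shift T (τ - σ) (x - y) a) * rep ω b -
        rep ω b * rep ω (shift T (τ - σ) (x - y) a)‖ := by
  have e : shift T τ x a = shift T σ y (shift T (τ - σ) (x - y) a) := by
    rw [shift_shift, add_sub_cancel, add_sub_cancel]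
  have inv : translateOp ω T (-σ) (-y) * translateOp ω T σ y = 1 := by
    rw [hinv.translateOp_mul, neg_add_cancel, neg_add_cancel, hinv.translateOp_zero]
  rw [e, hinv.rep_shift (ha.shift hinv _ _) σ y, hinv.rep_shift hb σ y]
  set S := rep ω (shift T (τ - σ) (x - y) a)
  set R := rep ω b
  set U := translateOp ω T σ y
  set V := translateOp ω T (-σ) (-y)
  have e2 : U * S * V * (U * R * V) - U * R * V * (U * S * V) = U * (S * R - R * S) * V := by
    calc _ = U * S * (V * U) * R * V - U * R * (V * U) * S * V := by simp only [mul_assoc]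
      _ = _ := by rw [inv]; noncomm_ring
  rw [e2]
  exact hinv.norm_conj_le _ σ y

lemma continuous_apply_of_bounded {X Y H : Type*} [TopologicalSpace X] [TopologicalSpace Y]
    [NormedAddCommGroup H] [NormedSpace 𝕜 H] {S : X → H →L[𝕜] H} {M : ℝ} (hS : ∀ x, ‖S x‖ ≤ M)
    (hc : ∀ v, Continuous fun x => S x v) {u : Y → H} (hu : Continuous u) :
    Continuous fun p : X × Y => S p.1 (u p.2) := by
  refine continuous_iff_continuousAt.2 fun ⟨x, y⟩ => ?_
  have hM : 0 ≤ M := (norm_nonneg _).trans (hS x)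
  have h1 : Tendsto (fun p : X × Y => S p.1 (u p.2 - u y)) (𝓝 (x, y)) (𝓝 0) := by
    have h2 : Tendsto (fun p : X × Y => M * ‖u p.2 - u y‖) (𝓝 (x, y)) (𝓝 0) := by
      have : Continuous fun p : X × Y => M * ‖u p.2 - u y‖ := by fun_prop
      simpa using this.tendsto (x, y)
    exact squeeze_zero_norm (fun p => ((S p.1).le_opNorm _).trans (by gcongr; exact hS _)) h2
  have h3 : Tendsto (fun p : X × Y => S p.1 (u y)) (𝓝 (x, y)) (𝓝 (S x (u y))) :=
    ((hc (u y)).comp continuous_fst).tendsto (x, y)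
  have := h1.add h3
  simpa [ContinuousAt] using this

lemma IsInvariantState.continuous_rep_shift (hinv : IsInvariantState ω T)
    (hcont : IsStronglyContinuous ω T) {a : A} (ha : IsBoundedElement ω a) (τ : ℝ) (v : GNS ω) :
    Continuous fun x : Space d => rep ω (shift T τ x a) v := by
  have h1 : ∀ w, Continuous fun x : Space d => translateOp ω T τ x w := fun w =>
    Continuous.comp (g := fun p : ℝ × Space d => translateOp ω T p.1 p.2 w)
      (f := fun x : Space d => (τ, x)) (hcont w) (by fun_prop)
  have h2 : Continuous fun x : Space d => translateOp ω T (-τ) (-x) v :=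
    Continuous.comp (g := fun p : ℝ × Space d => translateOp ω T p.1 p.2 v)
      (f := fun x : Space d => (-τ, -x)) (hcont v) (by fun_prop)
  have h3 : Continuous fun x : Space d => rep ω a (translateOp ω T (-τ) (-x) v) :=
    (rep ω a).continuous.comp h2
  have h4 := continuous_apply_of_bounded (S := fun x : Space d => translateOp ω T τ x)
    (fun x => hinv.norm_translateOp_le τ x) h1 h3
  have h5 : Continuous fun x : Space d => (x, x) := by fun_prop
  have h6 := h4.comp h5
  refine h6.congr fun x => ?_
  rw [hinv.rep_shift ha]
  rfl

end GNSOperators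

/-! ### Operators smeared with a function of the position -/

section Smear

variable {𝕜 H : Type*} [RCLike 𝕜] [NormedAddCommGroup H] [NormedSpace 𝕜 H] {d : ℕ}

section

lemma integrable_smear {u : Space d → 𝕜} {S : Space d → H →L[𝕜] H} {M : ℝ} (huc : Continuous u)
    (hu : Integrable u) (hM : ∀ x, ‖S x‖ ≤ M) (hS : ∀ v, Continuous fun x => S x v) (v : H) :
    Integrable fun x => u x • S x v := by
  refine Integrable.mono' (hu.norm.mul_const (M * ‖v‖)) (huc.smul (hS v)).aestronglyMeasurable
    (.of_forall fun x => ?_)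
  rw [norm_smul]
  gcongr
  exact ((S x).le_opNorm v).trans (by gcongr; exact hM x)

variable [NormedSpace ℝ H]

lemma norm_smear_le {u : Space d → 𝕜} {S : Space d → H →L[𝕜] H} {M : ℝ} (hu : Integrable u)
    (hM : ∀ x, ‖S x‖ ≤ M) (v : H) :
    ‖∫ x, u x • S x v‖ ≤ M * (∫ x, ‖u x‖) * ‖v‖ := by
  have : M * (∫ x, ‖u x‖) * ‖v‖ = ∫ x, ‖u x‖ * (M * ‖v‖) := by rw [integral_mul_const]; ring
  rw [this]
  refine norm_integral_le_of_norm_le (hu.norm.mul_const _) (.of_forall fun x => ?_)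
  rw [norm_smul]
  gcongr
  exact ((S x).le_opNorm v).trans (by gcongr; exact hM x)

variable [SMulCommClass ℝ 𝕜 H]

lemma exists_smear {u : Space d → 𝕜} {S : Space d → H →L[𝕜] H} {M : ℝ} (huc : Continuous u)
    (hu : Integrable u) (hM : ∀ x, ‖S x‖ ≤ M) (hS : ∀ v, Continuous fun x => S x v) :
    ∃ O : H →L[𝕜] H, ∀ v, O v = ∫ x, u x • S x v := by
  have hint := integrable_smear huc hu hM hS
  refine ⟨LinearMap.mkContinuous
    { toFun := fun v => ∫ x, u x • S x v
      map_add' := fun v w => by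
        rw [← integral_add (hint v) (hint w)]; simp only [map_add, smul_add]
      map_smul' := fun c v => by
        rw [RingHom.id_apply, ← integral_smul]
        simp only [map_smul, smul_comm c] } (M * ∫ x, ‖u x‖) fun v => norm_smear_le hu hM v,
    fun v => rfl⟩

/-- The commutator of two smeared operators, by Fubini's theorem. -/
lemma norm_smear_commutator_le [CompleteSpace H] {u w : Space d → 𝕜} {S R : Space d → H →L[𝕜] H}
    {M K : ℝ} (huc : Continuous u) (hu : Integrable u) (hM : ∀ x, ‖S x‖ ≤ M)
    (hS : ∀ v, Continuous fun x => S x v) (hwc : Continuous w) (hw : Integrable w)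
    (hK : ∀ x, ‖R x‖ ≤ K) (hR : ∀ v, Continuous fun x => R x v)
    {O P : H →L[𝕜] H} (hO : ∀ v, O v = ∫ x, u x • S x v) (hP : ∀ v, P v = ∫ x, w x • R x v)
    {ε : ℝ} (hε : ∀ x y, ‖u x‖ * ‖w y‖ * ‖S x * R y - R y * S x‖ ≤ ε * (weight x * weight y)) :
    ‖O * P - P * O‖ ≤ ε * (∫ x : Space d, weight x) ^ 2 := by
  have hε0 : 0 ≤ ε := by
    have h : 0 ≤ ε * (weight (0 : Space d) * weight (0 : Space d)) :=
      le_trans (by positivity) (hε 0 0)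
    simpa [weight] using h
  have hI : 0 ≤ ∫ x : Space d, weight x := integral_nonneg weight_nonneg
  have hM0 : 0 ≤ M := (norm_nonneg _).trans (hM 0)
  have hK0 : 0 ≤ K := (norm_nonneg _).trans (hK 0)
  refine ContinuousLinearMap.opNorm_le_bound _ (by positivity) fun v => ?_
  have e1 : (O * P) v = ∫ x, ∫ y, (u x * w y) • S x (R y v) := by
    rw [mul_apply_eq_comp, hO]
    refine integral_congr_ae (.of_forall fun x => ?_)
    simp only
    rw [hP, ← (S x).integral_comp_comm (integrable_smear hwc hw hK hR v), ← integral_smul]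
    simp only [map_smul, smul_smul]
  have hint1 : Integrable (fun p : Space d × Space d => (u p.1 * w p.2) • S p.1 (R p.2 v))
      (volume.prod volume) := by
    refine Integrable.mono' ((hu.norm.mul_prod hw.norm).mul_const (M * (K * ‖v‖))) ?_
      (.of_forall fun p => ?_)
    · refine Continuous.aestronglyMeasurable ?_
      exact ((huc.comp continuous_fst).mul (hwc.comp continuous_snd)).smul
        (continuous_apply_of_bounded hM hS (hR v))
    · rw [norm_smul, norm_mul]
      gcongr
      refine ((S p.1).le_opNorm _).trans ?_
      gcongr
      · exact hM _
      · exact ((R p.2).le_opNorm _).trans (by gcongr; exact hK _)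
  have hint2 : Integrable (fun p : Space d × Space d => (u p.1 * w p.2) • R p.2 (S p.1 v))
      (volume.prod volume) := by
    refine Integrable.mono' ((hu.norm.mul_prod hw.norm).mul_const (K * (M * ‖v‖))) ?_
      (.of_forall fun p => ?_)
    · refine Continuous.aestronglyMeasurable ?_
      exact ((huc.comp continuous_fst).mul (hwc.comp continuous_snd)).smul
        ((continuous_apply_of_bounded hK hR (hS v)).comp continuous_swap)
    · rw [norm_smul, norm_mul]
      gcongr
      refine ((R p.2).le_opNorm _).trans ?_
      gcongr
      · exact hK _
      · exact ((S p.1).le_opNorm _).trans (by gcongr; exact hM _)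
  have e2 : (P * O) v = ∫ x, ∫ y, (u x * w y) • R y (S x v) := by
    rw [integral_integral_swap (f := fun x y => (u x * w y) • R y (S x v)) hint2,
      mul_apply_eq_comp, hP]
    refine integral_congr_ae (.of_forall fun y => ?_)
    simp only
    rw [hO, ← (R y).integral_comp_comm (integrable_smear huc hu hM hS v), ← integral_smul]
    simp only [map_smul, smul_smul, mul_comm]
  have e3 : (O * P - P * O) v = ∫ p : Space d × Space d,
      (u p.1 * w p.2) • (S p.1 * R p.2 - R p.2 * S p.1) v ∂(volume.prod volume) := by
    rw [sub_apply, e1, e2, integral_integral hint1, integral_integral hint2,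
      ← integral_sub hint1 hint2]
    simp only [sub_apply, mul_apply_eq_comp, smul_sub]
  have e4 : ε * (∫ x : Space d, weight x) ^ 2 * ‖v‖ =
      ∫ p : Space d × Space d, ε * (weight p.1 * weight p.2) * ‖v‖ ∂(volume.prod volume) := by
    rw [integral_mul_const, integral_const_mul, integral_prod_mul weight weight, pow_two]
  rw [e3, e4]
  refine norm_integral_le_of_norm_le
    (((integrable_weight.mul_prod integrable_weight).const_mul ε).mul_const _)
    (.of_forall fun p => ?_)
  rw [norm_smul, norm_mul]
  calc _ ≤ ‖u p.1‖ * ‖w p.2‖ * (‖S p.1 * R p.2 - R p.2 * S p.1‖ * ‖v‖) := by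
        gcongr; exact ContinuousLinearMap.le_opNorm _ _
    _ = ‖u p.1‖ * ‖w p.2‖ * ‖S p.1 * R p.2 - R p.2 * S p.1‖ * ‖v‖ := by ring
    _ ≤ _ := mul_le_mul_of_nonneg_right (hε _ _) (norm_nonneg _)

end

lemma norm_map_le {𝕜₁ 𝕜₂ : Type*} [RCLike 𝕜₁] [RCLike 𝕜₂] (z : 𝕜₁) :
    ‖RCLike.map 𝕜₁ 𝕜₂ z‖ ≤ ‖z‖ := by
  rw [← sq_le_sq₀ (norm_nonneg _) (norm_nonneg _), RCLike.norm_sq_eq_def, RCLike.norm_sq_eq_def]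
  rcases RCLike.I_eq_zero_or_im_I_eq_one (K := 𝕜₂) with h | h
  · simp [h]; nlinarith [mul_self_nonneg (RCLike.im z)]
  · simp [h]

end Smear

section SmearedOperators

variable {𝕜 A : Type*} [RCLike 𝕜] [Ring A] [Algebra 𝕜 A] [StarRing A] [StarModule 𝕜 A]
variable {d m : ℕ} (ω : PosFunctional 𝕜 A) (T : TranslationAction 𝕜 A d)
variable (E : Space d → Matrix (Fin m) (Fin m) ℂ) (B : Fin m → A)

/-- The amplitude with which `B_j(τ, x)` occurs in `B(f, τ)`. -/
def amplitude (𝕜 : Type*) [RCLike 𝕜] (E : Space d → Matrix (Fin m) (Fin m) ℂ) (f : Family d m)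
    (τ : ℝ) (j : Fin m) (x : Space d) : 𝕜 :=
  RCLike.map ℂ 𝕜 (wave E f τ j x)

variable {E} in
lemma IsDispersion.continuous_amplitude (hE : IsDispersion 𝕜 E) (f : Family d m) (τ : ℝ)
    (j : Fin m) : Continuous (amplitude 𝕜 E f τ j) :=
  (RCLike.map ℂ 𝕜).continuous.comp (hE.continuous_wave f τ j)

variable {E} in
lemma IsDispersion.integrable_amplitude (hE : IsDispersion 𝕜 E) (f : Family d m) (τ : ℝ)
    (j : Fin m) : Integrable (amplitude 𝕜 E f τ j) := by
  obtain ⟨C, -, hC⟩ := hE.norm_wave_le_weight f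
  exact (integrable_weight.const_mul _).mono' (hE.continuous_amplitude f τ j).aestronglyMeasurable
    (.of_forall fun x => (norm_map_le _).trans (hC τ x j))

open Classical in
/-- The summand `∫ f̃^j_τ(x) B_j(τ, x) dx` of `B(f, τ)` as a bounded operator. -/
def smearedSummand (f : Family d m) (τ : ℝ) (j : Fin m) : GNS ω →L[𝕜] GNS ω :=
  letI : NormedSpace ℝ (GNS ω) := NormedSpace.restrictScalars ℝ 𝕜 (GNS ω)
  if h : ∃ O : GNS ω →L[𝕜] GNS ω, ∀ v, O v =
      ∫ x : Space d, amplitude 𝕜 E f τ j x • rep ω (shift T τ x (B j)) v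
  then h.choose else 0

/-- `B(f, τ)` as a bounded operator. -/
def smearedOp (f : Family d m) (τ : ℝ) : GNS ω →L[𝕜] GNS ω :=
  ∑ j, smearedSummand ω T E B f τ j

variable {ω T E B}

lemma smearedSummand_apply (hinv : IsInvariantState ω T) (hcont : IsStronglyContinuous ω T)
    (hE : IsDispersion 𝕜 E) (hB : ∀ j, IsBoundedElement ω (B j)) (f : Family d m) (τ : ℝ)
    (j : Fin m) (v : GNS ω) :
    letI : NormedSpace ℝ (GNS ω) := NormedSpace.restrictScalars ℝ 𝕜 (GNS ω)
    smearedSummand ω T E B f τ j v =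
      ∫ x : Space d, amplitude 𝕜 E f τ j x • rep ω (shift T τ x (B j)) v := by
  let : NormedSpace ℝ (GNS ω) := NormedSpace.restrictScalars ℝ 𝕜 (GNS ω)
  have h : ∃ O : GNS ω →L[𝕜] GNS ω, ∀ v, O v =
      ∫ x : Space d, amplitude 𝕜 E f τ j x • rep ω (shift T τ x (B j)) v :=
    exists_smear (hE.continuous_amplitude f τ j) (hE.integrable_amplitude f τ j)
      (fun x => hinv.norm_rep_shift_le (hB j) τ x) (hinv.continuous_rep_shift hcont (hB j) τ)
  rw [smearedSummand, dif_pos h]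
  exact h.choose_spec v

lemma smearedOp_apply (hinv : IsInvariantState ω T) (hcont : IsStronglyContinuous ω T)
    (hE : IsDispersion 𝕜 E) (hB : ∀ j, IsBoundedElement ω (B j)) (f : Family d m) (τ : ℝ)
    (v : GNS ω) : smearedOp ω T E B f τ v = smeared ω T E B f τ v := by
  rw [smearedOp, sum_apply]
  exact Finset.sum_congr rfl fun j _ => smearedSummand_apply hinv hcont hE hB f τ j v

lemma isPolyBounded_smearedOp (hinv : IsInvariantState ω T) (hcont : IsStronglyContinuous ω T)
    (hE : IsDispersion 𝕜 E) (hB : ∀ j, IsBoundedElement ω (B j)) (f : Family d m) :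
    IsPolyBounded (smearedOp ω T E B f) := by
  let : NormedSpace ℝ (GNS ω) := NormedSpace.restrictScalars ℝ 𝕜 (GNS ω)
  obtain ⟨C, hC0, hC⟩ := hE.norm_wave_le_weight f
  have hI : 0 ≤ ∫ x : Space d, weight x := integral_nonneg weight_nonneg
  refine ⟨d + 1, ∑ j, ‖rep ω (B j)‖ * (C * 2 ^ (d + 1) * ∫ x : Space d, weight x),
    fun τ hτ => ?_⟩
  rw [smearedOp, Finset.sum_mul]
  refine (norm_sum_le _ _).trans (Finset.sum_le_sum fun j _ => ?_)
  refine ContinuousLinearMap.opNorm_le_bound _ (by positivity) fun v => ?_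
  rw [smearedSummand_apply hinv hcont hE hB]
  refine (norm_smear_le (hE.integrable_amplitude f τ j)
    (fun x => hinv.norm_rep_shift_le (hB j) τ x) v).trans ?_
  have h1 : ∫ x, ‖amplitude 𝕜 E f τ j x‖ ≤ C * (1 + |τ|) ^ (d + 1) * ∫ x : Space d, weight x := by
    rw [← integral_const_mul]
    exact integral_mono (hE.integrable_amplitude f τ j).norm (integrable_weight.const_mul _)
      fun x => (norm_map_le _).trans (hC τ x j)
  have h2 : 1 + |τ| ≤ 2 * |τ| := by
    rw [abs_of_neg (by linarith)]; linarith
  refine mul_le_mul_of_nonneg_right ?_ (norm_nonneg _)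
  calc _ ≤ ‖rep ω (B j)‖ * (C * (2 * |τ|) ^ (d + 1) * ∫ x : Space d, weight x) := by
        gcongr; exact h1.trans (by gcongr)
    _ = _ := by ring

/-- Asymptotic commutation of `B(f, τ)` and `B(g, σ)`, given a bound of the product of the two waves
by a rapidly decreasing function of time, at the cost of a power of the distance. -/
lemma rapidlyCommute_smearedOp (hinv : IsInvariantState ω T) (hcont : IsStronglyContinuous ω T)
    (hE : IsDispersion 𝕜 E) (hB : ∀ j, IsBoundedElement ω (B j))
    (hcomm : AsymptoticallyCommute ω T B) {f g : Family d m}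
    (hfg : ∀ N : ℕ, ∃ (r : ℕ) (C : ℝ), ∀ τ σ : ℝ, τ ≤ -1 → σ ≤ -1 → |τ - σ| ≤ 1 →
      ∀ (x y : Space d) (j l : Fin m), |τ| ^ N * (‖wave E f τ j x‖ * ‖wave E g σ l y‖) ≤
        C * (1 + ‖x - y‖ ^ r) * (weight x * weight y)) :
    RapidlyCommute (smearedOp ω T E B f) (smearedOp ω T E B g) := by
  let : NormedSpace ℝ (GNS ω) := NormedSpace.restrictScalars ℝ 𝕜 (GNS ω)
  intro N
  obtain ⟨r, C, hC⟩ := hfg N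
  -- The polynomials in the commutator bounds are bounded for relative times in `[-1, 1]`.
  have hD : ∃ D : ℝ, 0 ≤ D ∧ ∀ (j l : Fin m) (t : ℝ) (x : Space d), |t| ≤ 1 →
      ‖rep ω (shift T t x (B j)) * rep ω (B l) - rep ω (B l) * rep ω (shift T t x (B j))‖ ≤
        D / (1 + ‖x‖ ^ r) := by
    choose c hc using hcomm r
    have : ∀ j l, ∃ D : ℝ, 0 ≤ D ∧ ∀ t : ℝ, |t| ≤ 1 → (c j l).eval t ≤ D := fun j l => by
      obtain ⟨D, hD⟩ := (isCompact_Icc (a := (-1 : ℝ)) (b := 1)).bddAbove_image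
        (c j l).continuous.continuousOn
      exact ⟨|D|, abs_nonneg D, fun t ht =>
        (hD (Set.mem_image_of_mem _ (abs_le.1 ht))).trans (le_abs_self D)⟩
    choose D hD0 hD using this
    refine ⟨∑ j, ∑ l, D j l, Finset.sum_nonneg fun j _ => Finset.sum_nonneg fun l _ => hD0 j l,
      fun j l t x ht => (hc j l t x).trans ?_⟩
    gcongr
    exact (hD j l t ht).trans ((Finset.single_le_sum (f := fun l => D j l) (fun l _ => hD0 j l)
      (Finset.mem_univ l)).trans (Finset.single_le_sum (f := fun j => ∑ l, D j l)
        (fun j _ => Finset.sum_nonneg fun l _ => hD0 j l) (Finset.mem_univ j)))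
  obtain ⟨D, hD0, hD⟩ := hD
  refine ⟨∑ _j : Fin m, ∑ _l : Fin m, C * D * (∫ x : Space d, weight x) ^ 2,
    fun τ σ hτ hσ hd => ?_⟩
  have hpos : 0 < |τ| ^ N := pow_pos (abs_pos.2 (by linarith)) N
  have e : smearedOp ω T E B f τ * smearedOp ω T E B g σ -
      smearedOp ω T E B g σ * smearedOp ω T E B f τ = ∑ j, ∑ l,
      (smearedSummand ω T E B f τ j * smearedSummand ω T E B g σ l -
        smearedSummand ω T E B g σ l * smearedSummand ω T E B f τ j) := by
    simp only [smearedOp, Finset.sum_mul_sum, Finset.sum_sub_distrib]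
    rw [Finset.sum_comm (f := fun i j => smearedSummand ω T E B g σ i * smearedSummand ω T E B f τ j)]
  rw [← le_div_iff₀ hpos]
  simp only [e]
  rw [Finset.sum_div]
  refine (norm_sum_le _ _).trans (Finset.sum_le_sum fun j _ => ?_)
  rw [Finset.sum_div]
  refine (norm_sum_le _ _).trans (Finset.sum_le_sum fun l _ => ?_)
  rw [mul_div_right_comm]
  refine norm_smear_commutator_le (hE.continuous_amplitude f τ j) (hE.integrable_amplitude f τ j)
    (fun x => hinv.norm_rep_shift_le (hB j) τ x) (hinv.continuous_rep_shift hcont (hB j) τ)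
    (hE.continuous_amplitude g σ l) (hE.integrable_amplitude g σ l)
    (fun x => hinv.norm_rep_shift_le (hB l) σ x) (hinv.continuous_rep_shift hcont (hB l) σ)
    (smearedSummand_apply hinv hcont hE hB f τ j) (smearedSummand_apply hinv hcont hE hB g σ l)
    fun x y => ?_
  have h1 := (hinv.norm_commutator_le (hB j) (hB l) τ σ x y).trans (hD j l (τ - σ) (x - y) hd)
  have h2 := hC τ σ hτ hσ hd x y j l
  have h3 : (0 : ℝ) < 1 + ‖x - y‖ ^ r := by positivity
  calc _ ≤ ‖wave E f τ j x‖ * ‖wave E g σ l y‖ * (D / (1 + ‖x - y‖ ^ r)) := by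
        gcongr
        · exact norm_map_le _
        · exact norm_map_le _
    _ = (|τ| ^ N * (‖wave E f τ j x‖ * ‖wave E g σ l y‖)) * (D / (1 + ‖x - y‖ ^ r) / |τ| ^ N) := by
        field_simp
    _ ≤ (C * (1 + ‖x - y‖ ^ r) * (weight x * weight y)) * (D / (1 + ‖x - y‖ ^ r) / |τ| ^ N) := by
        gcongr
    _ = _ := by field_simp

end SmearedOperators

/-! ### Products of non-overlapping waves -/

section PairsOfWaves

variable {𝕜 : Type*} [RCLike 𝕜] {d m : ℕ} {E : Space d → Matrix (Fin m) (Fin m) ℂ}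

lemma IsDispersion.wave_le_of_not_mem (hE : IsDispersion 𝕜 E) {f : Family d m} {K : Set (Space d)}
    (hK : IsEssentialSupport E f K) {c : ℝ} (hc : 0 < c) (M D : ℕ) :
    ∃ C : ℝ, 0 ≤ C ∧ ∀ (τ : ℝ) (x : Space d) (j : Fin m), τ ≤ -1 →
      (τ⁻¹ • x ∉ K ∨ c * |τ| ^ 2 ≤ ‖x‖) → |τ| ^ M * ((1 + ‖x‖) ^ D * ‖wave E f τ j x‖) ≤ C := by
  obtain ⟨C₁, hC₁⟩ := hK (M + D)
  obtain ⟨C₂, hC₂0, hC₂⟩ := hE.wave_bound f (M + 2 * D)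
  refine ⟨|C₁| * 2 ^ (M + D) + C₂ * 2 ^ (M + 2 * D) / c ^ (M + D), by positivity,
    fun τ x j hτ hx => ?_⟩
  have ht : 1 ≤ |τ| := by rw [abs_of_neg (by linarith)]; linarith
  have hX : 1 ≤ 1 + ‖x‖ := by linarith [norm_nonneg x]
  rcases hx with hx | hx
  · have h := hC₁ τ x (by linarith) hx j
    set Q := 1 + ‖x‖ ^ 2 + τ ^ 2
    have hQ : 0 < Q := by positivity
    have hQ' : |τ| * (1 + ‖x‖) ≤ 2 * Q := by
      have : |τ| ^ 2 = τ ^ 2 := sq_abs τ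
      nlinarith [sq_nonneg (|τ| - (1 + ‖x‖)), sq_nonneg (1 - ‖x‖)]
    have : |τ| ^ M * (1 + ‖x‖) ^ D ≤ (2 * Q) ^ (M + D) := by
      calc _ ≤ |τ| ^ (M + D) * (1 + ‖x‖) ^ (M + D) := by
            gcongr <;> first | exact ht | exact hX | omega
        _ = (|τ| * (1 + ‖x‖)) ^ (M + D) := by rw [mul_pow]
        _ ≤ _ := by gcongr
    calc _ = |τ| ^ M * (1 + ‖x‖) ^ D * ‖wave E f τ j x‖ := by ring
      _ ≤ (2 * Q) ^ (M + D) * (|C₁| / Q ^ (M + D)) := by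
          gcongr
          exact h.trans (by gcongr; exact le_abs_self _)
      _ = |C₁| * 2 ^ (M + D) := by rw [mul_pow]; field_simp
      _ ≤ _ := by
          have : 0 ≤ C₂ * 2 ^ (M + 2 * D) / c ^ (M + D) := by positivity
          linarith
  · -- `(c|τ|²)^(M+D) (1+|x|)^D ≤ (1+|x|)^(M+2D)`, and `2(M+D) = M + (M+2D)`.
    have h := hC₂ τ x j
    have h1 : c * |τ| ^ 2 ≤ 1 + ‖x‖ := by linarith
    have hp : 0 < |τ| ^ (M + 2 * D) := by positivity
    have h2 : |τ| ^ M * ((1 + ‖x‖) ^ D * ‖wave E f τ j x‖) ≤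
        C₂ * 2 ^ (M + 2 * D) / c ^ (M + D) := by
      rw [le_div_iff₀ (by positivity)]
      refine le_of_mul_le_mul_right ?_ hp
      calc _ = (c * |τ| ^ 2) ^ (M + D) * (1 + ‖x‖) ^ D * ‖wave E f τ j x‖ := by
            rw [mul_pow, ← pow_mul, show 2 * (M + D) = M + (M + 2 * D) by ring, pow_add |τ|]; ring
        _ ≤ (1 + ‖x‖) ^ (M + D) * (1 + ‖x‖) ^ D * ‖wave E f τ j x‖ := by gcongr
        _ = (1 + ‖x‖) ^ (M + 2 * D) * ‖wave E f τ j x‖ := by ring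
        _ ≤ C₂ * (1 + |τ|) ^ (M + 2 * D) := h
        _ ≤ C₂ * (2 * |τ|) ^ (M + 2 * D) := by gcongr; linarith
        _ = _ := by rw [mul_pow]; ring
    have : 0 ≤ |C₁| * 2 ^ (M + D) := by positivity
    linarith

/-- The product of two waves with essential supports at positive distance, at nearby times `τ, σ`. If
`x = τu` and `y = σv` with velocities `u, v` in the supports and `|u|` small compared with `|τ|`, then
`x - y = σ(u - v) + (τ - σ)u` is of order `|τ|`; in all other cases one of the waves is small. -/
lemma IsDispersion.wave_mul_wave_le (hE : IsDispersion 𝕜 E) {f g : Family d m}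
    {K L : Set (Space d)} (hK : IsEssentialSupport E f K) (hL : IsEssentialSupport E g L)
    {δ : ℝ} (hδ : 0 < δ) (hKL : ∀ u ∈ K, ∀ v ∈ L, δ ≤ dist u v) (N : ℕ) :
    ∃ (r : ℕ) (C : ℝ), ∀ τ σ : ℝ, τ ≤ -1 → σ ≤ -1 → |τ - σ| ≤ 1 →
      ∀ (x y : Space d) (j l : Fin m), |τ| ^ N * (‖wave E f τ j x‖ * ‖wave E g σ l y‖) ≤
        C * (1 + ‖x - y‖ ^ r) * (weight x * weight y) := by
  set D := d + 1
  obtain ⟨F, hF0, hF⟩ := hE.wave_bound f D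
  obtain ⟨G, hG0, hG⟩ := hE.wave_bound g D
  obtain ⟨F', hF'0, hF'⟩ := hE.wave_le_of_not_mem hK (c := δ / 4) (by positivity) (N + D) D
  obtain ⟨G', hG'0, hG'⟩ := hE.wave_le_of_not_mem hL (c := δ / 4) (by positivity) (N + D) D
  set C₁ := F' * (G * 3 ^ D)
  set C₂ := F * 2 ^ D * 2 ^ (N + D) * G'
  set C₃ := F * 2 ^ D * (G * 3 ^ D) * (4 / δ) ^ (N + 2 * D)
  have hC₁ : 0 ≤ C₁ := by positivity
  have hC₂ : 0 ≤ C₂ := by positivity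
  have hC₃ : 0 ≤ C₃ := by positivity
  refine ⟨N + 2 * D, C₁ + C₂ + C₃, fun τ σ hτ hσ hd x y j l => ?_⟩
  have ht : 1 ≤ |τ| := by rw [abs_of_neg (by linarith)]; linarith
  have hs : 1 ≤ |σ| := by rw [abs_of_neg (by linarith)]; linarith
  have hts : |τ| ≤ 2 * |σ| := abs_le_two_mul_abs hτ hσ hd
  have hst : |σ| ≤ 2 * |τ| := abs_le_two_mul_abs hσ hτ (by rwa [abs_sub_comm])
  set a := (1 + ‖x‖) ^ D * ‖wave E f τ j x‖
  set b := (1 + ‖y‖) ^ D * ‖wave E g σ l y‖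
  have ha0 : 0 ≤ a := by positivity
  have hb0 : 0 ≤ b := by positivity
  have ha : a ≤ F * 2 ^ D * |τ| ^ D :=
    calc a ≤ F * (1 + |τ|) ^ D := hF τ x j
      _ ≤ F * (2 * |τ|) ^ D := by gcongr; linarith
      _ = _ := by rw [mul_pow]; ring
  have hb : b ≤ G * 3 ^ D * |τ| ^ D :=
    calc b ≤ G * (1 + |σ|) ^ D := hG σ y l
      _ ≤ G * (3 * |τ|) ^ D := by gcongr; linarith
      _ = _ := by rw [mul_pow]; ring
  suffices h : |τ| ^ N * (a * b) ≤ (C₁ + C₂ + C₃) * (1 + ‖x - y‖ ^ (N + 2 * D)) by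
    simp only [weight]
    rw [← mul_inv, ← div_eq_mul_inv, le_div_iff₀ (by positivity)]
    refine le_trans (le_of_eq ?_) h
    simp only [a, b]
    ring
  have hr : 0 ≤ ‖x - y‖ ^ (N + 2 * D) := by positivity
  have h1r : 1 ≤ 1 + ‖x - y‖ ^ (N + 2 * D) := by linarith
  by_cases hx : τ⁻¹ • x ∉ K ∨ δ / 4 * |τ| ^ 2 ≤ ‖x‖
  · calc _ ≤ |τ| ^ N * (a * (G * 3 ^ D * |τ| ^ D)) := by gcongr
      _ = |τ| ^ (N + D) * a * (G * 3 ^ D) := by ring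
      _ ≤ C₁ := mul_le_mul_of_nonneg_right (hF' τ x j hτ hx) (by positivity)
      _ ≤ (C₁ + C₂ + C₃) * 1 := by linarith
      _ ≤ _ := by gcongr
  by_cases hy : σ⁻¹ • y ∉ L
  · calc _ ≤ |τ| ^ N * (F * 2 ^ D * |τ| ^ D * b) := by gcongr
      _ = F * 2 ^ D * (|τ| ^ (N + D) * b) := by ring
      _ ≤ F * 2 ^ D * ((2 * |σ|) ^ (N + D) * b) := by gcongr
      _ = F * 2 ^ D * 2 ^ (N + D) * (|σ| ^ (N + D) * b) := by rw [mul_pow]; ring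
      _ ≤ C₂ := mul_le_mul_of_nonneg_left (hG' σ y l hσ (Or.inl hy)) (by positivity)
      _ ≤ (C₁ + C₂ + C₃) * 1 := by linarith
      _ ≤ _ := by gcongr
  push Not at hx hy
  obtain ⟨hxK, hxs⟩ := hx
  have hdist : |τ| ≤ 4 / δ * ‖x - y‖ := by
    set u := τ⁻¹ • x
    set v := σ⁻¹ • y
    have hxu : x = τ • u := by rw [smul_inv_smul₀ (by linarith)]
    have hyv : y = σ • v := by rw [smul_inv_smul₀ (by linarith)]
    have h1 : σ • (u - v) = (x - y) - (τ - σ) • u := by rw [hxu, hyv]; module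
    have h2 : |σ| * δ ≤ ‖σ • (u - v)‖ := by
      rw [norm_smul, Real.norm_eq_abs, ← dist_eq_norm]
      gcongr
      exact hKL u hxK v hy
    have h3 : ‖(τ - σ) • u‖ ≤ δ / 4 * |τ| := by
      have h4 : |τ| * ‖u‖ ≤ |τ| * (δ / 4 * |τ|) := by
        have : |τ| * ‖u‖ = ‖x‖ := by
          rw [← Real.norm_eq_abs, ← norm_smul, ← hxu]
        rw [this]
        linarith
      have h5 := le_of_mul_le_mul_left h4 (by linarith)
      rw [norm_smul, Real.norm_eq_abs]
      exact (mul_le_of_le_one_left (norm_nonneg _) hd).trans h5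
    have h6 : |σ| * δ ≤ ‖x - y‖ + δ / 4 * |τ| := by
      rw [h1] at h2
      linarith [norm_sub_le (x - y) ((τ - σ) • u)]
    rw [div_mul_eq_mul_div, le_div_iff₀ hδ]
    nlinarith
  calc _ ≤ |τ| ^ N * (F * 2 ^ D * |τ| ^ D * (G * 3 ^ D * |τ| ^ D)) := by gcongr
    _ = F * 2 ^ D * (G * 3 ^ D) * |τ| ^ (N + 2 * D) := by ring
    _ ≤ F * 2 ^ D * (G * 3 ^ D) * (4 / δ * ‖x - y‖) ^ (N + 2 * D) := by gcongr
    _ = C₃ * ‖x - y‖ ^ (N + 2 * D) := by rw [mul_pow]; ring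
    _ ≤ _ := by gcongr <;> linarith

end PairsOfWaves

/-! ### Real and complex scalars -/

section Scalars

variable {𝕜 : Type*} [RCLike 𝕜]

lemma map_toComplex_re (z : 𝕜) : (RCLike.map 𝕜 ℂ z).re = RCLike.re z := by simp

lemma map_toComplex_im (z : 𝕜) : (RCLike.map 𝕜 ℂ z).im = RCLike.im z := by simp

lemma map_toComplex_injective : Function.Injective (RCLike.map 𝕜 ℂ) := fun z w h => by
  apply RCLike.ext
  · rw [← map_toComplex_re, h, map_toComplex_re]
  · rw [← map_toComplex_im, h, map_toComplex_im]

lemma map_toComplex_mul (z w : 𝕜) :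
    RCLike.map 𝕜 ℂ (z * w) = RCLike.map 𝕜 ℂ z * RCLike.map 𝕜 ℂ w := by
  apply Complex.ext
  · rw [Complex.mul_re]; simp only [map_toComplex_re, map_toComplex_im, RCLike.mul_re]
  · rw [Complex.mul_im]; simp only [map_toComplex_re, map_toComplex_im, RCLike.mul_im]

lemma map_toComplex_conj (z : 𝕜) :
    RCLike.map 𝕜 ℂ (starRingEnd 𝕜 z) = starRingEnd ℂ (RCLike.map 𝕜 ℂ z) := by
  apply Complex.ext
  · rw [Complex.conj_re]; simp only [map_toComplex_re, RCLike.conj_re]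
  · rw [Complex.conj_im]; simp only [map_toComplex_im, RCLike.conj_im]

/-- Passing from complex to `𝕜`-valued numbers and back loses nothing if the number is real in the
case `𝕜 = ℝ`. -/
lemma map_toComplex_map {z : ℂ} (hz : (RCLike.I : 𝕜) = 0 → starRingEnd ℂ z = z) :
    RCLike.map 𝕜 ℂ (RCLike.map ℂ 𝕜 z) = z := by
  rcases RCLike.I_eq_zero_or_im_I_eq_one (K := 𝕜) with h | h
  · have := Complex.conj_eq_iff_im.1 (hz h)
    apply Complex.ext
    · rw [map_toComplex_re]; simp
    · rw [map_toComplex_im]; simp [h, this]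
  · apply Complex.ext
    · rw [map_toComplex_re]; simp
    · rw [map_toComplex_im]; simp [h]

end Scalars

/-! ### The elementary space in the momentum representation -/

section Momentum

variable {𝕜 : Type*} [RCLike 𝕜] {d m : ℕ} {E : Space d → Matrix (Fin m) (Fin m) ℂ}

lemma conj_fourierInv (u : Space d → ℂ) (ξ : Space d) :
    starRingEnd ℂ (𝓕⁻ u ξ) = 𝓕⁻ (fun x => starRingEnd ℂ (u x)) (-ξ) := by
  rw [Real.fourierInv_eq', Real.fourierInv_eq', ← integral_conj]
  refine integral_congr_ae (.of_forall fun x => ?_)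
  simp [← Complex.exp_conj, map_ofNat]

lemma conj_fourier (u : Space d → ℂ) (x : Space d) :
    starRingEnd ℂ (𝓕 u x) = 𝓕 (fun ξ => starRingEnd ℂ (u (-ξ))) x := by
  rw [Real.fourier_eq', Real.fourier_eq', ← integral_conj, ← integral_neg_eq_self]
  refine integral_congr_ae (.of_forall fun ξ => ?_)
  simp [← Complex.exp_conj, map_ofNat]

lemma fourierInv_comp_sub (u : Space d → ℂ) (a ξ : Space d) :
    𝓕⁻ (fun x => u (x - a)) ξ =
      Complex.exp ((2 * Real.pi * ⟪ξ, a⟫_ℝ : ℝ) * Complex.I) * 𝓕⁻ u ξ := by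
  rw [Real.fourierInv_eq', Real.fourierInv_eq', ← integral_const_mul,
    ← integral_add_right_eq_self _ a]
  refine integral_congr_ae (.of_forall fun x => ?_)
  simp only [add_sub_cancel_right, smul_eq_mul, ← mul_assoc, ← Complex.exp_add]
  rw [inner_add_left, real_inner_comm a ξ]
  push_cast
  ring_nf

lemma IsDispersion.conj_evolEntry (hE : IsDispersion 𝕜 E) (h𝕜 : (RCLike.I : 𝕜) = 0) (τ : ℝ)
    (a b : Fin m) (ξ : Space d) :
    starRingEnd ℂ (evolEntry E τ a b ξ) = evolEntry E τ a b (-ξ) := by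
  have h : (Complex.I * (τ : ℂ)) • E (toMomentum d (-ξ)) =
      (((Complex.I * (τ : ℂ)) • E (toMomentum d ξ)).conjTranspose).transpose := by
    ext α β
    rw [map_neg, Matrix.smul_apply, hE.reality h𝕜, Matrix.transpose_apply,
      Matrix.conjTranspose_apply, Matrix.smul_apply]
    simp
  rw [evolEntry, evolEntry, evol, evol, h, Matrix.exp_transpose, Matrix.exp_conjTranspose]
  rfl

/-- The component `α` of an element of the elementary space, as a complex-valued function. -/
def component (g : Elementary 𝕜 d m) (α : Fin m) : 𝓢(Space d, ℂ) :=
  SchwartzMap.postcompCLM ((RCLike.map 𝕜 ℂ).comp (PiLp.proj (𝕜 := ℝ) 2 (fun _ : Fin m => 𝕜) α)) g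

lemma component_apply (g : Elementary 𝕜 d m) (α : Fin m) (x : Space d) :
    component g α x = RCLike.map 𝕜 ℂ (g x α) := rfl

/-- The element of the elementary space with given components. -/
def ofComponents (𝕜 : Type*) [RCLike 𝕜] (q : Fin m → 𝓢(Space d, ℂ)) : Elementary 𝕜 d m :=
  ∑ α, SchwartzMap.postcompCLM
    (((PiLp.continuousLinearEquiv 2 ℝ (fun _ : Fin m => 𝕜)).symm.toContinuousLinearMap.comp
      (ContinuousLinearMap.single ℝ (fun _ : Fin m => 𝕜) α)).comp (RCLike.map ℂ 𝕜)) (q α)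

lemma ofComponents_apply (q : Fin m → 𝓢(Space d, ℂ)) (x : Space d) (α : Fin m) :
    ofComponents 𝕜 q x α = RCLike.map ℂ 𝕜 (q α x) := by
  simp only [ofComponents, sum_apply, SchwartzMap.postcompCLM_apply]
  simp [Pi.single_apply, -RCLike.map_apply]

lemma component_ofComponents {q : Fin m → 𝓢(Space d, ℂ)}
    (hq : (RCLike.I : 𝕜) = 0 → ∀ α x, starRingEnd ℂ (q α x) = q α x) (α : Fin m) :
    component (ofComponents 𝕜 q) α = q α := by
  ext x
  rw [component_apply, ofComponents_apply, map_toComplex_map fun h => hq h α x]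

/-- The momentum representation as a function of the frequency. -/
def frequency (g : Elementary 𝕜 d m) (α : Fin m) : 𝓢(Space d, ℂ) := 𝓕⁻ (component g α)

lemma momentum_toMomentum (g : Elementary 𝕜 d m) (ξ : Space d) (α : Fin m) :
    momentum g (toMomentum d ξ) α = frequency g α ξ := by
  rw [momentum, toMomentum_apply, inv_smul_smul₀ (by positivity), frequency,
    SchwartzMap.fourierInv_coe]
  rfl

lemma conj_frequency (h𝕜 : (RCLike.I : 𝕜) = 0) (g : Elementary 𝕜 d m) (α : Fin m) (ξ : Space d) :
    starRingEnd ℂ (frequency g α ξ) = frequency g α (-ξ) := by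
  rw [frequency, SchwartzMap.fourierInv_coe, conj_fourierInv]
  have h : (fun x => starRingEnd ℂ (component g α x)) = component g α := funext fun x => ?_
  · rw [h]
  rw [component_apply, ← map_toComplex_conj]
  congr 1
  apply RCLike.conj_eq_iff_im.2
  rw [RCLike.im_eq_zero h𝕜]

/-- The time translate of an element of the elementary space: `exp(-iτE)` in the momentum
representation. -/
def evolve (E : Space d → Matrix (Fin m) (Fin m) ℂ) (τ : ℝ) (g : Elementary 𝕜 d m) :
    Elementary 𝕜 d m :=
  ofComponents 𝕜 fun α =>
    𝓕 (∑ β, SchwartzMap.smulLeftCLM ℂ (evolEntry E (-τ) α β) (frequency g β))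

lemma IsDispersion.frequency_evolve (hE : IsDispersion 𝕜 E) (τ : ℝ) (g : Elementary 𝕜 d m)
    (α : Fin m) (ξ : Space d) :
    frequency (evolve E τ g) α ξ = ∑ β, evolEntry E (-τ) α β ξ * frequency g β ξ := by
  have happ : ∀ (α : Fin m) (ξ : Space d),
      (∑ β, SchwartzMap.smulLeftCLM ℂ (evolEntry E (-τ) α β) (frequency g β)) ξ =
        ∑ β, evolEntry E (-τ) α β ξ * frequency g β ξ := fun α ξ => by
    rw [sum_apply]
    refine Finset.sum_congr rfl fun β _ => ?_
    rw [SchwartzMap.smulLeftCLM_apply_apply (hE.evolEntry_hasTemperateGrowth _ _ _), smul_eq_mul]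
  rw [frequency, evolve, component_ofComponents, FourierTransform.fourierInv_fourier_eq, happ]
  intro h𝕜 α x
  rw [SchwartzMap.fourier_coe, conj_fourier]
  refine congrFun (congrArg 𝓕 (funext fun ξ => ?_)) x
  rw [happ, happ, map_sum]
  refine Finset.sum_congr rfl fun β _ => ?_
  rw [map_mul, hE.conj_evolEntry h𝕜, conj_frequency h𝕜, neg_neg]

/-- The space translate of an element of the elementary space. -/
def translate (x : Space d) (g : Elementary 𝕜 d m) : Elementary 𝕜 d m :=
  SchwartzMap.compSubConstCLM ℝ x g

lemma frequency_translate (x : Space d) (g : Elementary 𝕜 d m) (α : Fin m) (ξ : Space d) :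
    frequency (translate x g) α ξ =
      Complex.exp ((2 * Real.pi * ⟪ξ, x⟫_ℝ : ℝ) * Complex.I) * frequency g α ξ := by
  rw [frequency, frequency, SchwartzMap.fourierInv_coe, SchwartzMap.fourierInv_coe,
    ← fourierInv_comp_sub]
  rfl

lemma IsDispersion.isTranslate (hE : IsDispersion 𝕜 E) (τ : ℝ) (x : Space d)
    (g : Elementary 𝕜 d m) : IsTranslate E τ x g (translate x (evolve E τ g)) := by
  intro k
  obtain ⟨ξ, rfl⟩ := (toMomentum d).surjective k
  funext α
  rw [momentum_toMomentum, frequency_translate, hE.frequency_evolve, Pi.smul_apply, smul_eq_mul]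
  congr 1
  · rw [toMomentum_apply, real_inner_smul_left, mul_comm]
  · simp only [Matrix.mulVec, dotProduct, momentum_toMomentum]
    rfl

/-- The waves of real families are real. -/
lemma IsDispersion.conj_wave (hE : IsDispersion 𝕜 E) (h𝕜 : (RCLike.I : 𝕜) = 0) {f : Family d m}
    (hf : IsReal 𝕜 f) (τ : ℝ) (j : Fin m) (x : Space d) :
    starRingEnd ℂ (wave E f τ j x) = wave E f τ j x := by
  rw [hE.wave_eq, SchwartzMap.fourier_coe, conj_fourier]
  refine congrFun (congrArg 𝓕 (funext fun ξ => ?_)) x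
  rw [hE.symbol_apply, hE.symbol_apply, map_sum]
  refine Finset.sum_congr rfl fun i _ => ?_
  rw [map_mul, hE.conj_evolEntry h𝕜, hf h𝕜, neg_neg, map_neg (toMomentum d), neg_neg]

end Momentum

/-! ### One-particle states -/

section OneParticle

variable {𝕜 : Type*} [RCLike 𝕜] {d m : ℕ} {E : Space d → Matrix (Fin m) (Fin m) ℂ}

lemma inner_eq_integral_inner {H : Type*} [NormedAddCommGroup H] [InnerProductSpace 𝕜 H]
    {L : Elementary 𝕜 d m →ₗ[𝕜] H} (hL : ∀ g, ‖L g‖ ^ 2 = ∫ x, ‖g x‖ ^ 2)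
    (g h : Elementary 𝕜 d m) : ⟪L g, L h⟫_𝕜 = ∫ x, ⟪g x, h x⟫_𝕜 := by
  set J : Elementary 𝕜 d m →L[𝕜] Lp (EuclideanSpace 𝕜 (Fin m)) 2 (volume : Measure (Space d)) :=
    SchwartzMap.toLpCLM 𝕜 (EuclideanSpace 𝕜 (Fin m)) 2 volume
  have hJ : ∀ g h, ⟪J g, J h⟫_𝕜 = ∫ x, ⟪g x, h x⟫_𝕜 := fun g h => by
    rw [L2.inner_def]
    apply integral_congr_ae
    filter_upwards [g.coeFn_toLp 2 volume, h.coeFn_toLp 2 volume] with x hg hh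
    change ⟪(g.toLp 2 volume) x, (h.toLp 2 volume) x⟫_𝕜 = _
    rw [hg, hh]
  have hn : ∀ g, ((‖L g‖ : ℝ) : 𝕜) ^ 2 = ((‖J g‖ : ℝ) : 𝕜) ^ 2 := fun g => by
    rw [← inner_self_eq_norm_sq_to_K (𝕜 := 𝕜) (J g), hJ, ← RCLike.ofReal_pow, hL, ← integral_ofReal]
    simp only [inner_self_eq_norm_sq_to_K, RCLike.ofReal_pow]
  rw [← hJ, inner_eq_sum_norm_sq_div_four, inner_eq_sum_norm_sq_div_four]
  simp only [← map_add, ← map_sub, ← map_smul, hn]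

/-- Parseval's formula in the elementary space. -/
lemma map_inner_eq_sum_integral {H : Type*} [NormedAddCommGroup H] [InnerProductSpace 𝕜 H]
    {L : Elementary 𝕜 d m →ₗ[𝕜] H} (hL : ∀ g, ‖L g‖ ^ 2 = ∫ x, ‖g x‖ ^ 2)
    (g h : Elementary 𝕜 d m) : RCLike.map 𝕜 ℂ ⟪L g, L h⟫_𝕜 =
      ∑ α, ∫ ξ, starRingEnd ℂ (frequency g α ξ) * frequency h α ξ := by
  have hpars : ∀ α, ∫ ξ, starRingEnd ℂ (frequency g α ξ) * frequency h α ξ =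
      ∫ x, starRingEnd ℂ (component g α x) * component h α x := fun α => by
    have := SchwartzMap.integral_inner_fourier_fourier (frequency g α) (frequency h α)
    simp only [frequency, FourierTransform.fourier_fourierInv_eq, RCLike.inner_apply] at this
    simp only [mul_comm (starRingEnd ℂ _), frequency]
    exact this.symm
  have hint : ∀ α, Integrable fun x =>
      starRingEnd ℂ (component g α x) * component h α x := fun α => by
    have h1 : Continuous fun x => starRingEnd ℂ (component g α x) :=
      Complex.continuous_conj.comp (component g α).continuous
    obtain ⟨C, hC⟩ : ∃ C, ∀ x, ‖starRingEnd ℂ (component g α x)‖ ≤ C :=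
      ⟨_, fun x => by
        rw [RCLike.norm_conj]; exact (component g α).norm_le_seminorm ℂ x⟩
    exact (component h α).integrable.bdd_mul h1.aestronglyMeasurable (.of_forall hC)
  simp only [hpars]
  rw [← integral_finsetSum _ fun α _ => hint α, inner_eq_integral_inner hL]
  have hint' : Integrable fun x => ⟪g x, h x⟫_𝕜 :=
    Integrable.mono' ((h.integrable (μ := volume)).norm.const_mul _)
      (by fun_prop : Continuous fun x => ⟪g x, h x⟫_𝕜).aestronglyMeasurable
      (.of_forall fun x => (norm_inner_le_norm _ _).trans
        (mul_le_mul_of_nonneg_right (g.norm_le_seminorm ℝ x) (norm_nonneg _)))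
  rw [← (RCLike.map 𝕜 ℂ).integral_comp_comm hint']
  refine integral_congr_ae (.of_forall fun x => ?_)
  simp only [PiLp.inner_apply, RCLike.inner_apply, map_sum, map_toComplex_mul, map_toComplex_conj,
    component_apply]
  exact Finset.sum_congr rfl fun α _ => mul_comm _ _

lemma integrable_mul (u v : 𝓢(Space d, ℂ)) : Integrable fun x => u x * v x :=
  v.integrable.bdd_mul u.continuous.aestronglyMeasurable
    (.of_forall fun x => u.norm_le_seminorm ℂ x)

/-- The function `ξ ↦ conj (ĥ^α) (exp(-iτE) φ̂)^α` of the frequency. -/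
def overlap (E : Space d → Matrix (Fin m) (Fin m) ℂ) (τ : ℝ) (h φ : Elementary 𝕜 d m)
    (α : Fin m) : 𝓢(Space d, ℂ) :=
  SchwartzMap.smulLeftCLM ℂ (fun ξ => starRingEnd ℂ (frequency h α ξ)) (frequency (evolve E τ φ) α)

lemma overlap_apply (τ : ℝ) (h φ : Elementary 𝕜 d m) (α : Fin m) (ξ : Space d) :
    overlap E τ h φ α ξ =
      starRingEnd ℂ (frequency h α ξ) * frequency (evolve E τ φ) α ξ := by
  have : (fun ξ => starRingEnd ℂ (frequency h α ξ)).HasTemperateGrowth :=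
    Complex.conjCLE.toContinuousLinearMap.hasTemperateGrowth.comp
      (frequency h α).hasTemperateGrowth
  rw [overlap, SchwartzMap.smulLeftCLM_apply_apply this, smul_eq_mul]

/-- The overlap with a translated vector, as a function of the translation, is a Fourier
transform. -/
lemma map_inner_translate {H : Type*} [NormedAddCommGroup H] [InnerProductSpace 𝕜 H]
    {L : Elementary 𝕜 d m →ₗ[𝕜] H} (hL : ∀ g, ‖L g‖ ^ 2 = ∫ x, ‖g x‖ ^ 2)
    (τ : ℝ) (h φ : Elementary 𝕜 d m) (x : Space d) :
    RCLike.map 𝕜 ℂ ⟪L h, L (translate x (evolve E τ φ))⟫_𝕜 =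
      ∑ α, 𝓕⁻ (overlap E τ h φ α) x := by
  rw [map_inner_eq_sum_integral hL]
  refine Finset.sum_congr rfl fun α _ => ?_
  rw [SchwartzMap.fourierInv_coe, Real.fourierInv_eq']
  refine integral_congr_ae (.of_forall fun ξ => ?_)
  simp only [overlap_apply, frequency_translate, smul_eq_mul]
  ring

lemma IsDispersion.integral_wave_mul (hE : IsDispersion 𝕜 E) (f : Family d m) (τ : ℝ) (j : Fin m)
    (u : 𝓢(Space d, ℂ)) :
    ∫ x, wave E f τ j x * 𝓕⁻ u x = ∫ ξ, symbol E f τ j ξ * u ξ := by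
  rw [hE.wave_eq, ← SchwartzMap.integral_fourierInv_mul_eq, FourierTransform.fourierInv_fourier_eq]

lemma evol_neg_mulVec_evol (E : Space d → Matrix (Fin m) (Fin m) ℂ) (τ : ℝ) (k : Space d)
    {M : Matrix (Fin m) (Fin m) ℂ} (hM : Commute M (E k)) :
    evol E (-τ) k * (M * evol E τ k) = M := by
  have hc : Commute M (evol E τ k) := by
    have : Commute M ((Complex.I * (τ : ℂ)) • E k) := hM.smul_right _
    exact this.exp_right
  have hinv : evol E (-τ) k * evol E τ k = 1 := by
    rw [evol, evol, ← Matrix.exp_add_of_commute]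
    · rw [← add_smul]; simp
    · exact ((Commute.refl (E k)).smul_left _).smul_right _
  rw [hc.eq, ← mul_assoc, hinv, one_mul]

/-- As the matrix `φ(k)` commutes with `E(k)`, the evolution of the families and the evolution of the
particles compensate. -/
lemma IsDispersion.sum_symbol_mul_overlap (hE : IsDispersion 𝕜 E) (f : Family d m)
    {φ : Fin m → Elementary 𝕜 d m} (hφ : ∀ k, Commute (momentumMatrix φ k) (E k))
    (τ : ℝ) (h : Elementary 𝕜 d m) (ξ : Space d) :
    ∑ j, ∑ α, symbol E f τ j ξ * overlap E τ h (φ j) α ξ =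
      ∑ α, starRingEnd ℂ (frequency h α ξ) *
        ((momentumMatrix φ (toMomentum d ξ)).mulVec fun i => f i (toMomentum d ξ)) α := by
  rw [Finset.sum_comm]
  refine Finset.sum_congr rfl fun α _ => ?_
  conv_rhs => rw [← evol_neg_mulVec_evol E τ _ (hφ (toMomentum d ξ)), ← Matrix.mulVec_mulVec,
    ← Matrix.mulVec_mulVec]
  simp only [hE.symbol_apply, overlap_apply, hE.frequency_evolve, Matrix.mulVec, dotProduct,
    momentumMatrix, Matrix.of_apply, momentum_toMomentum, evolEntry]
  simp only [Finset.mul_sum, Finset.sum_mul]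
  rw [Finset.sum_comm]
  refine Finset.sum_congr rfl fun β _ => Finset.sum_congr rfl fun j _ =>
    Finset.sum_congr rfl fun i _ => ?_
  ring

end OneParticle

section Stationarity

variable {𝕜 A : Type*} [RCLike 𝕜] [Ring A] [Algebra 𝕜 A] [StarRing A] [StarModule 𝕜 A]
variable {d m : ℕ} {ω : PosFunctional 𝕜 A} {T : TranslationAction 𝕜 A d}
variable {E : Space d → Matrix (Fin m) (Fin m) ℂ} {exc : Elementary 𝕜 d m →ₗ[𝕜] GNS ω}
  {B : Fin m → A} {φ : Fin m → Elementary 𝕜 d m}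

lemma rep_shift_vacuum (hinv : IsInvariantState ω T) (hE : IsDispersion 𝕜 E)
    (hexc : IsElementaryExcitation ω T E exc) (hB : IsGood ω E exc B φ) (τ : ℝ) (x : Space d)
    (j : Fin m) : rep ω (shift T τ x (B j)) (vacuum ω) =
      exc (translate x (evolve E τ (φ j))) := by
  rw [vacuum, rep_vec ω ((hB.bounded j).shift hinv τ x), mul_one, ← hinv.translateOp_vec,
    hB.apply_vacuum, hexc.intertwines τ x _ _ (hE.isTranslate τ x (φ j))]

/-- The overlaps of `B(f, τ)Φ` with one-particle states do not depend on `τ`. -/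
lemma map_inner_smearedOp_vacuum (hinv : IsInvariantState ω T) (hcont : IsStronglyContinuous ω T)
    (hE : IsDispersion 𝕜 E) (hexc : IsElementaryExcitation ω T E exc) (hB : IsGood ω E exc B φ)
    {f : Family d m} (hf : IsReal 𝕜 f) (τ : ℝ) (h : Elementary 𝕜 d m) :
    RCLike.map 𝕜 ℂ ⟪exc h, smearedOp ω T E B f τ (vacuum ω)⟫_𝕜 =
      ∫ ξ, ∑ α, starRingEnd ℂ (frequency h α ξ) *
        ((momentumMatrix φ (toMomentum d ξ)).mulVec fun i => f i (toMomentum d ξ)) α := by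
  let : NormedSpace ℝ (GNS ω) := NormedSpace.restrictScalars ℝ 𝕜 (GNS ω)
  have hj : ∀ j, RCLike.map 𝕜 ℂ ⟪exc h, smearedSummand ω T E B f τ j (vacuum ω)⟫_𝕜 =
      ∑ α, ∫ ξ, symbol E f τ j ξ * overlap E τ h (φ j) α ξ := fun j => by
    have hint : Integrable fun x : Space d =>
        amplitude 𝕜 E f τ j x • rep ω (shift T τ x (B j)) (vacuum ω) :=
      integrable_smear (hE.continuous_amplitude f τ j) (hE.integrable_amplitude f τ j)
        (fun x => hinv.norm_rep_shift_le (hB.bounded j) τ x)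
        (hinv.continuous_rep_shift hcont (hB.bounded j) τ) _
    rw [smearedSummand_apply hinv hcont hE hB.bounded, ← integral_inner hint,
      ← (RCLike.map 𝕜 ℂ).integral_comp_comm (hint.const_inner _)]
    have e : ∀ x : Space d, RCLike.map 𝕜 ℂ
        ⟪exc h, amplitude 𝕜 E f τ j x • rep ω (shift T τ x (B j)) (vacuum ω)⟫_𝕜 =
        ∑ α, wave E f τ j x * 𝓕⁻ (overlap E τ h (φ j) α) x := fun x => by
      rw [inner_smul_right, map_toComplex_mul, rep_shift_vacuum hinv hE hexc hB,
        map_inner_translate hexc.isometric, amplitude,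
        map_toComplex_map fun h𝕜 => hE.conj_wave h𝕜 hf τ j x, Finset.mul_sum]
    simp only [e]
    rw [integral_finsetSum]
    · exact Finset.sum_congr rfl fun α _ => hE.integral_wave_mul f τ j _
    · intro α _
      rw [hE.wave_eq]
      exact integrable_mul _ _
  rw [smearedOp, sum_apply, inner_sum, map_sum]
  simp only [hj]
  rw [Finset.sum_congr rfl fun j _ => (integral_finsetSum _ fun α _ => integrable_mul _ _).symm,
    ← integral_finsetSum _ fun j _ => integrable_finsetSum _ fun α _ => integrable_mul _ _]
  exact integral_congr_ae (.of_forall fun ξ => hE.sum_symbol_mul_overlap f hB.commute τ h ξ)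

/-- The one-particle vector `B(f, τ)Φ` does not depend on `τ`: a difference of two such vectors is
orthogonal to all one-particle states, hence to itself. -/
lemma smearedOp_vacuum (hinv : IsInvariantState ω T) (hcont : IsStronglyContinuous ω T)
    (hE : IsDispersion 𝕜 E) (hexc : IsElementaryExcitation ω T E exc) (hB : IsGood ω E exc B φ)
    {f : Family d m} (hf : IsReal 𝕜 f) (τ σ : ℝ) :
    smearedOp ω T E B f τ (vacuum ω) = smearedOp ω T E B f σ (vacuum ω) := by
  let : NormedSpace ℝ (GNS ω) := NormedSpace.restrictScalars ℝ 𝕜 (GNS ω)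
  set D := smearedOp ω T E B f τ (vacuum ω) - smearedOp ω T E B f σ (vacuum ω)
  have h1 : ∀ h, ⟪D, exc h⟫_𝕜 = 0 := fun h => by
    rw [inner_eq_zero_symm]
    apply map_toComplex_injective
    simp only [D]
    rw [inner_sub_right, map_sub, map_inner_smearedOp_vacuum hinv hcont hE hexc hB hf,
      map_inner_smearedOp_vacuum hinv hcont hE hexc hB hf, sub_self, map_zero]
  have h2 : ∀ ρ, ⟪D, smearedOp ω T E B f ρ (vacuum ω)⟫_𝕜 = 0 := fun ρ => by
    rw [smearedOp, sum_apply, inner_sum]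
    refine Finset.sum_eq_zero fun j _ => ?_
    have hint : Integrable fun x : Space d =>
        amplitude 𝕜 E f ρ j x • rep ω (shift T ρ x (B j)) (vacuum ω) :=
      integrable_smear (hE.continuous_amplitude f ρ j) (hE.integrable_amplitude f ρ j)
        (fun x => hinv.norm_rep_shift_le (hB.bounded j) ρ x)
        (hinv.continuous_rep_shift hcont (hB.bounded j) ρ) _
    rw [smearedSummand_apply hinv hcont hE hB.bounded, ← integral_inner hint]
    simp only [inner_smul_right, rep_shift_vacuum hinv hE hexc hB, h1, mul_zero, integral_zero]
  refine sub_eq_zero.1 (inner_self_eq_zero.1 (?_ : ⟪D, D⟫_𝕜 = 0))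
  conv_lhs => rw [show D = _ - _ from rfl, inner_sub_right]
  rw [h2, h2, sub_zero]

end Stationarity

end Scattering

end

theorem lemma2 {𝕜 A : Type*} [RCLike 𝕜] [Ring A] [Algebra 𝕜 A] [StarRing A] [StarModule 𝕜 A]
    {d m : ℕ}
    (ω : Scattering.PosFunctional 𝕜 A) (T : Scattering.TranslationAction 𝕜 A d)
    (hinv : Scattering.IsInvariantState ω T) (hcont : Scattering.IsStronglyContinuous ω T)
    (E : Scattering.Space d → Matrix (Fin m) (Fin m) ℂ) (hE : Scattering.IsDispersion 𝕜 E)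
    (exc : Scattering.Elementary 𝕜 d m →ₗ[𝕜] Scattering.GNS ω)
    (hexc : Scattering.IsElementaryExcitation ω T E exc)
    (B : Fin m → A) (φ : Fin m → Scattering.Elementary 𝕜 d m)
    (hB : Scattering.IsGood ω E exc B φ)
    (hcomm : Scattering.AsymptoticallyCommute ω T B) :
    ∃ Ψ : (n : ℕ) → (Fin n → Scattering.Family d m) → Scattering.GNS ω,
      (∀ (n : ℕ) (f : Fin n → Scattering.Family d m), (∀ a, Scattering.IsReal 𝕜 (f a)) →
        Scattering.NonOverlapping E f →
          Tendsto (fun τ : ℝ => Scattering.scatVec ω T E B f fun _ => τ) atBot (𝓝 (Ψ n f)) ∧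
          ∀ p : ℕ, Tendsto (Scattering.scatVec ω T E B f) (Scattering.remotePast n p)
            (𝓝 (Ψ n f))) ∧
      Submodule.span 𝕜 {v | ∃ (n : ℕ) (f : Fin n → Scattering.Family d m),
        (∀ a, Scattering.IsReal 𝕜 (f a)) ∧ Scattering.NonOverlapping E f ∧ v = Ψ n f} =
          Scattering.domainMinus ω T E B := by
  have hpoly := Scattering.isPolyBounded_smearedOp hinv hcont hE hB.bounded
  -- The operators `B(f_a, τ)` of a non-overlapping family satisfy the hypotheses of the abstract
  -- convergence result.
  have hops : ∀ (n : ℕ) (f : Fin n → Scattering.Family d m), (∀ a, Scattering.IsReal 𝕜 (f a)) →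
      Scattering.NonOverlapping E f → Scattering.AsymptoticOperators
        (fun a => Scattering.smearedOp ω T E B (f a)) (Scattering.vacuum ω) := by
    rintro n f hf ⟨K, hK, hdist⟩
    refine ⟨fun a => hpoly (f a), fun a b hab => ?_, fun a τ σ =>
      Scattering.smearedOp_vacuum hinv hcont hE hexc hB (hf a) τ σ⟩
    obtain ⟨δ, hδ, hKL⟩ := hdist a b hab
    exact Scattering.rapidlyCommute_smearedOp hinv hcont hE hB.bounded hcomm
      (hE.wave_mul_wave_le (hK a) (hK b) hδ hKL)
  have hvec : ∀ (n : ℕ) (f : Fin n → Scattering.Family d m),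
      Scattering.scatVec ω T E B f = fun t => Scattering.prodApply
        (fun a => Scattering.smearedOp ω T E B (f a)) t (Scattering.vacuum ω) := fun n f => by
    funext t
    simp only [Scattering.scatVec, Scattering.prodApply,
      Scattering.smearedOp_apply hinv hcont hE hB.bounded]
  have hlim : ∀ (n : ℕ) (f : Fin n → Scattering.Family d m), (∀ a, Scattering.IsReal 𝕜 (f a)) →
      Scattering.NonOverlapping E f → Tendsto (fun τ : ℝ => Scattering.scatVec ω T E B f fun _ => τ)
        atBot (𝓝 (limUnder atBot fun τ : ℝ => Scattering.scatVec ω T E B f fun _ => τ)) := by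
    intro n f hf hno
    obtain ⟨v, hv⟩ := (hops n f hf hno).exists_tendsto
    simp only [hvec]
    exact tendsto_nhds_limUnder ⟨v, hv⟩
  refine ⟨fun n f => limUnder atBot fun τ : ℝ => Scattering.scatVec ω T E B f fun _ => τ,
    fun n f hf hno => ⟨hlim n f hf hno, fun p => ?_⟩, ?_⟩
  · have h := hlim n f hf hno
    have hp := (hops n f hf hno).tendsto_remotePast (by rwa [hvec] at h) p
    rwa [← hvec] at hp
  · rw [Scattering.domainMinus]
    congr 1
    ext v
    constructor
    · rintro ⟨n, f, hf, hno, rfl⟩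
      exact ⟨n, f, hf, hno, hlim n f hf hno⟩
    · rintro ⟨n, f, hf, hno, hv⟩
      exact ⟨n, f, hf, hno, hv.limUnder_eq.symm⟩
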